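/- Let $k$ be a commutative ring and let $\mathcal H=(\mathcal H_L,\mathcal H_R,S)$ be a Hopf algebroid over $k$, with total algebra $H$, left bialgebroid $\mathcal H_L=(H,L,s_L,t_L,\gamma_L,\pi_L)$, right bialgebroid $\mathcal H_R=(H,R,s_R,t_R,\gamma_R,\pi_R)$ and antipode $S$ (not assumed bijective). Write $\gamma_L(h)=h_{(1)}\otimes_L h_{(2)}$ and $\gamma_R(h)=h^{(1)}\otimes_R h^{(2)}$. Let $A$ be a right $\mathcal H$-comodule algebra with $R$-ring unit map $\eta_R:R\to A$, and let $B=\{a\in A:\varrho_R(a)=a\otimes_R 1_H\}$ be the subalgebra of coinvariants of the $\mathcal H_R$-coaction $\varrho_R$. Assume that $B\subseteq A$ is $\mathcal H$-cleft: $A$ is an $L$-ring with unit map $\eta_L:L\to A$ such that $\eta_L(L)\subseteq B$, and there is a cleaving map, that is, a left $L$-linear right $\mathcal H$-colinear map $j:H\to A$ with a convolution inverse $j^c:H\to A$, meaning $$j^c(t_L(l)\,h\,t_R(r))=\eta_R(r)j^c(h)\eta_L(l),\qquad j(h^{(1)})j^c(h^{(2)})=\eta_L(\pi_L(h)),\qquad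 j^c(h_{(1)})j(h_{(2)})=\eta_R(\pi_R(h)).$$ Then there is a normalised cleaving map $j$, i.e. one with $j(1_H)=1_A=j^c(1_H)$. Moreover, for every normalised cleaving map $j$, the formulas $$h\cdot b=j(h^{(1)})\,b\,j^c(h^{(2)}),\qquad \sigma(h,h')=j(h^{(1)})\,j(h'^{(1)})\,j^c(h^{(2)}h'^{(2)})$$ define a measuring of the $L$-ring $B$ by $\mathcal H_L$ and an invertible $B$-valued 2-cocycle $\sigma$ on $\mathcal H_L$ for which $B$ is a $\sigma$-twisted left $\mathcal H_L$-module. Hence the crossed product $B\#_\sigma\mathcal H_L$, i.e. $B\otimes_L H$ with the product $$(b\otimes_L h)(b'\otimes_L h')=b\,(h_{(1)}\cdot b')\,\sigma(h_{(2)},h'_{(1)})\otimes_L h_{(3)}h'_{(2)},$$ is an associative algebra with unit $1_B\otimes_L 1_H$. There is an isomorphism $A\to B\#_\sigma\mathcal H_L$ of left $B$-modules and of right $\mathcal H$-comodule algebras, where $B\#_\sigma\mathcal H_L$ has the coactions $B\otimes_L\gamma_R$ and $B\otimes_L\gamma_L$. -/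

import Mathlib

open scoped TensorProduct
open MulOpposite

universe u₁ u₂ u₃ u₄ u₅ u₆ u₇

/-! ### Tensor products over non-commutative rings

All modules are modules over a commutative ring `k`.  If `M` is a right module and `N` a left
module over a `k`-algebra `P`, with actions `a p : M → M` and `b p : N → N`, then `M ⊗_P N` is
the quotient of `M ⊗[k] N` by the relations `(m · p) ⊗ n = m ⊗ (p · n)`. -/

section Balanced

variable {k : Type u₁} [CommRing k] {P : Type u₂} {Q : Type u₃}
  {M : Type u₄} [AddCommGroup M] [Module k M]
  {N : Type u₅} [AddCommGroup N] [Module k N]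
  {T : Type u₆} [AddCommGroup T] [Module k T]
  {V : Type u₇} [AddCommGroup V] [Module k V]

/-- The relations `(m · p) ⊗ n - m ⊗ (p · n)`. -/
def balancedRel (a : P → Module.End k M) (b : P → Module.End k N) :
    Submodule k (M ⊗[k] N) :=
  Submodule.span k {x | ∃ p m n, x = (a p m) ⊗ₜ[k] n - m ⊗ₜ[k] (b p n)}

/-- The tensor product `M ⊗_P N`, for the right action `a` of `P` on `M` and the left action `b`
of `P` on `N`. -/
def BalTensor (a : P → Module.End k M) (b : P → Module.End k N) : Type (max u₄ u₅) :=
  (M ⊗[k] N) ⧸ balancedRel a b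

namespace BalTensor

variable (a : P → Module.End k M) (b : P → Module.End k N)

instance : AddCommGroup (BalTensor a b) :=
  inferInstanceAs (AddCommGroup ((M ⊗[k] N) ⧸ balancedRel a b))

instance : Module k (BalTensor a b) :=
  inferInstanceAs (Module k ((M ⊗[k] N) ⧸ balancedRel a b))

/-- The universal balanced map `(m, n) ↦ m ⊗_P n`. -/
def mk : M →ₗ[k] N →ₗ[k] BalTensor a b :=
  (TensorProduct.mk k M N).compr₂ (Submodule.mkQ (balancedRel a b))

variable {a b}

/-- The pure tensor `m ⊗_P n`. -/
def tmul (m : M) (n : N) : BalTensor a b := mk a b m n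

theorem mk_apply (m : M) (n : N) : mk a b m n = tmul m n := rfl

theorem tmul_balanced (p : P) (m : M) (n : N) :
    (tmul (a p m) n : BalTensor a b) = tmul m (b p n) :=
  (Submodule.Quotient.eq (balancedRel a b)).2 (Submodule.subset_span ⟨p, m, n, rfl⟩)

/-- The linear map out of `M ⊗_P N` induced by a balanced bilinear map. -/
def lift (f : M →ₗ[k] N →ₗ[k] T) (hf : ∀ p m n, f (a p m) n = f m (b p n)) :
    BalTensor a b →ₗ[k] T :=
  Submodule.liftQ (balancedRel a b) (TensorProduct.lift f) (by
    refine Submodule.span_le.2 ?_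
    rintro _ ⟨p, m, n, rfl⟩
    simp [hf])

@[simp] theorem lift_tmul (f : M →ₗ[k] N →ₗ[k] T)
    (hf : ∀ p m n, f (a p m) n = f m (b p n)) (m : M) (n : N) :
    lift f hf (tmul m n) = f m n := by
  change TensorProduct.lift f (m ⊗ₜ[k] n) = _
  simp

@[elab_as_elim] theorem induction_on {C : BalTensor a b → Prop} (x : BalTensor a b)
    (zero : C 0) (tmul : ∀ m n, C (tmul m n)) (add : ∀ x y, C x → C y → C (x + y)) : C x := by
  induction x using Submodule.Quotient.induction_on with
  | _ z =>
    induction z using TensorProduct.induction_on with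
    | zero => exact zero
    | tmul m n => exact tmul m n
    | add x y hx hy => exact add _ _ hx hy

theorem hom_ext {f g : BalTensor a b →ₗ[k] T} (h : ∀ m n, f (tmul m n) = g (tmul m n)) :
    f = g := by
  ext x
  induction x using induction_on with
  | zero => simp
  | tmul m n => exact h m n
  | add x y hx hy => simp [hx, hy]

/-- A way of writing `x` as a finite sum `∑ᵢ fst i ⊗_P snd i`; the indexed version of Sweedler's
notation. -/
structure Rep (x : BalTensor a b) where
  n : ℕ
  fst : Fin n → M
  snd : Fin n → N
  eq : x = ∑ i, tmul (fst i) (snd i)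

theorem Rep.map_eq {x : BalTensor a b} (r : Rep x) (f : BalTensor a b →ₗ[k] T) :
    f x = ∑ i, f (tmul (r.fst i) (r.snd i)) :=
  (congrArg f r.eq).trans (map_sum _ _ _)

theorem nonempty_rep (x : BalTensor a b) : Nonempty (Rep x) := by
  induction x using induction_on with
  | zero => exact ⟨⟨0, Fin.elim0, Fin.elim0, by simp⟩⟩
  | tmul m n => exact ⟨⟨1, fun _ => m, fun _ => n, by simp⟩⟩
  | add x y hx hy =>
    obtain ⟨r⟩ := hx
    obtain ⟨r'⟩ := hy
    exact ⟨⟨r.n + r'.n, Fin.append r.fst r'.fst, Fin.append r.snd r'.snd, by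
      refine (congrArg₂ (· + ·) r.eq r'.eq).trans ?_
      rw [Fin.sum_univ_add]; simp⟩⟩

end BalTensor

/-- The relations of `M ⊗_P N ⊗_Q T`. -/
def balancedRel₃ (a : P → Module.End k M) (b : P → Module.End k N)
    (c : Q → Module.End k N) (d : Q → Module.End k T) : Submodule k (M ⊗[k] (N ⊗[k] T)) :=
  Submodule.span k
    ({x | ∃ p m n t, x = (a p m) ⊗ₜ[k] (n ⊗ₜ[k] t) - m ⊗ₜ[k] ((b p n) ⊗ₜ[k] t)} ∪
      {x | ∃ q m n t, x = m ⊗ₜ[k] ((c q n) ⊗ₜ[k] t) - m ⊗ₜ[k] (n ⊗ₜ[k] (d q t))})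

/-- The three-fold tensor product `M ⊗_P N ⊗_Q T`, where `a` is the right `P`-action on `M`,
`b` the left `P`-action on `N`, `c` the right `Q`-action on `N` and `d` the left `Q`-action
on `T` (the actions `b` and `c` commute wherever this is used). -/
def BalTensor₃ (a : P → Module.End k M) (b : P → Module.End k N)
    (c : Q → Module.End k N) (d : Q → Module.End k T) : Type (max u₄ u₅ u₆) :=
  (M ⊗[k] (N ⊗[k] T)) ⧸ balancedRel₃ a b c d

namespace BalTensor₃

variable (a : P → Module.End k M) (b : P → Module.End k N)
  (c : Q → Module.End k N) (d : Q → Module.End k T)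

instance : AddCommGroup (BalTensor₃ a b c d) :=
  inferInstanceAs (AddCommGroup ((M ⊗[k] (N ⊗[k] T)) ⧸ balancedRel₃ a b c d))

instance : Module k (BalTensor₃ a b c d) :=
  inferInstanceAs (Module k ((M ⊗[k] (N ⊗[k] T)) ⧸ balancedRel₃ a b c d))

variable {a b c d}

variable (a b c d) in
/-- The quotient map onto `M ⊗_P N ⊗_Q T`. -/
def mkQ : M ⊗[k] (N ⊗[k] T) →ₗ[k] BalTensor₃ a b c d := Submodule.mkQ (balancedRel₃ a b c d)

/-- The canonical map `(x, t) ↦ x ⊗_Q t`, for `x ∈ M ⊗_P N` and `t ∈ T`. -/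
def left : BalTensor a b →ₗ[k] T →ₗ[k] BalTensor₃ a b c d :=
  BalTensor.lift
    (LinearMap.mk₂ k
      (fun m n => mkQ a b c d ∘ₗ TensorProduct.mk k M (N ⊗[k] T) m ∘ₗ TensorProduct.mk k N T n)
      (fun _ _ _ => by ext; simp) (fun _ _ _ => by ext; simp)
      (fun _ _ _ => by ext; simp [TensorProduct.tmul_add]) (fun _ _ _ => by ext; simp))
    (fun p m n => by
      ext t
      exact (Submodule.Quotient.eq (balancedRel₃ a b c d)).2
        (Submodule.subset_span (Or.inl ⟨p, m, n, t, rfl⟩)))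

/-- The canonical map `(m, y) ↦ m ⊗_P y`, for `m ∈ M` and `y ∈ N ⊗_Q T`. -/
def right : M →ₗ[k] BalTensor c d →ₗ[k] BalTensor₃ a b c d :=
  LinearMap.flip (BalTensor.lift
    (LinearMap.mk₂ k
      (fun n t => mkQ a b c d ∘ₗ (TensorProduct.mk k M (N ⊗[k] T)).flip (n ⊗ₜ[k] t))
      (fun _ _ _ => by ext; simp [TensorProduct.add_tmul])
      (fun _ _ _ => by ext; simp [← TensorProduct.smul_tmul'])
      (fun _ _ _ => by ext; simp [TensorProduct.tmul_add])
      (fun _ _ _ => by ext; simp))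
    (fun q n t => by
      ext m
      exact (Submodule.Quotient.eq (balancedRel₃ a b c d)).2
        (Submodule.subset_span (Or.inr ⟨q, m, n, t, rfl⟩))))

@[simp] theorem left_tmul (m : M) (n : N) (t : T) :
    (left (BalTensor.tmul m n) t : BalTensor₃ a b c d) = mkQ a b c d (m ⊗ₜ[k] (n ⊗ₜ[k] t)) := by
  simp [left]

@[simp] theorem right_tmul (m : M) (n : N) (t : T) :
    (right m (BalTensor.tmul n t) : BalTensor₃ a b c d) = mkQ a b c d (m ⊗ₜ[k] (n ⊗ₜ[k] t)) := by
  simp [right]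

/-- The linear map out of `M ⊗_P N ⊗_Q T` induced by a balanced linear map. -/
def lift (f : M ⊗[k] (N ⊗[k] T) →ₗ[k] V)
    (h₁ : ∀ p m n t, f (a p m ⊗ₜ[k] (n ⊗ₜ[k] t)) = f (m ⊗ₜ[k] (b p n ⊗ₜ[k] t)))
    (h₂ : ∀ q m n t, f (m ⊗ₜ[k] (c q n ⊗ₜ[k] t)) = f (m ⊗ₜ[k] (n ⊗ₜ[k] d q t))) :
    BalTensor₃ a b c d →ₗ[k] V :=
  Submodule.liftQ (balancedRel₃ a b c d) f (by
    refine Submodule.span_le.2 ?_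
    rintro _ (⟨p, m, n, t, rfl⟩ | ⟨p, m, n, t, rfl⟩)
    · simp [h₁]
    · simp [h₂])

theorem lift_mkQ (f : M ⊗[k] (N ⊗[k] T) →ₗ[k] V)
    (h₁ : ∀ p m n t, f (a p m ⊗ₜ[k] (n ⊗ₜ[k] t)) = f (m ⊗ₜ[k] (b p n ⊗ₜ[k] t)))
    (h₂ : ∀ q m n t, f (m ⊗ₜ[k] (c q n ⊗ₜ[k] t)) = f (m ⊗ₜ[k] (n ⊗ₜ[k] d q t)))
    (x : M ⊗[k] (N ⊗[k] T)) : lift f h₁ h₂ (mkQ a b c d x) = f x := rfl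

end BalTensor₃

end Balanced

/-! ### Bialgebroids and Hopf algebroids

An identity such as `∑ S(h₍₁₎) h₍₂₎ = …` is expressed by quantifying over all ways
`r : (γ h).Rep` of writing `γ h` as a finite sum of pure tensors. -/

/-- Left multiplications `x ↦ f p * x` by the values of `f`. -/
def lmulBy (k : Type u₁) [CommRing k] {P : Type u₂} {A : Type u₃} [Ring A] [Algebra k A]
    (f : P → A) : P → Module.End k A := fun p => LinearMap.mulLeft k (f p)

/-- Right multiplications `x ↦ x * f p` by the values of `f`. -/
def rmulBy (k : Type u₁) [CommRing k] {P : Type u₂} {A : Type u₃} [Ring A] [Algebra k A]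
    (f : P → A) : P → Module.End k A := fun p => LinearMap.mulRight k (f p)

/-- A left bialgebroid `(H, L, s, t, γ, π)`.  As an `L`-bimodule, `H` has the actions
`l · h · l' = s(l) t(l') h`. -/
structure LeftBialgebroid (k : Type u₁) (L : Type u₂) (H : Type u₃) [CommRing k]
    [Ring L] [Algebra k L] [Ring H] [Algebra k H] where
  s : L →ₐ[k] H
  t : Lᵐᵒᵖ →ₐ[k] H
  s_comm_t : ∀ l l', s l * t (op l') = t (op l') * s l
  γ : H →ₗ[k] BalTensor (lmulBy k fun l => t (op l)) (lmulBy k fun l => s l)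
  π : H →ₗ[k] L
  γ_s : ∀ l h (r : (γ h).Rep),
    γ (s l * h) = ∑ i, BalTensor.tmul (s l * r.fst i) (r.snd i)
  γ_t : ∀ l h (r : (γ h).Rep),
    γ (t (op l) * h) = ∑ i, BalTensor.tmul (r.fst i) (t (op l) * r.snd i)
  π_s : ∀ l h, π (s l * h) = l * π h
  π_t : ∀ l h, π (t (op l) * h) = π h * l
  coassoc : ∀ h (r : (γ h).Rep),
    (∑ i, BalTensor₃.left (γ (r.fst i)) (r.snd i) :
      BalTensor₃ (lmulBy k fun l => t (op l)) (lmulBy k fun l => s l)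
        (lmulBy k fun l => t (op l)) (lmulBy k fun l => s l)) =
    ∑ i, BalTensor₃.right (r.fst i) (γ (r.snd i))
  counit_left : ∀ h (r : (γ h).Rep), ∑ i, s (π (r.fst i)) * r.snd i = h
  counit_right : ∀ h (r : (γ h).Rep), ∑ i, t (op (π (r.snd i))) * r.fst i = h
  takeuchi : ∀ l h (r : (γ h).Rep),
    (∑ i, BalTensor.tmul (r.fst i * t (op l)) (r.snd i) :
      BalTensor (lmulBy k fun l => t (op l)) (lmulBy k fun l => s l)) =
    ∑ i, BalTensor.tmul (r.fst i) (r.snd i * s l)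
  γ_one : γ 1 = BalTensor.tmul 1 1
  γ_mul : ∀ h h' (r : (γ h).Rep) (r' : (γ h').Rep),
    γ (h * h') = ∑ i, ∑ j, BalTensor.tmul (r.fst i * r'.fst j) (r.snd i * r'.snd j)
  π_one : π 1 = 1
  π_mul_s : ∀ h h', π (h * s (π h')) = π (h * h')
  π_mul_t : ∀ h h', π (h * t (op (π h'))) = π (h * h')

/-- A right bialgebroid `(H, R, s, t, γ, π)`.  As an `R`-bimodule, `H` has the actions
`r · h · r' = h s(r') t(r)`. -/
structure RightBialgebroid (k : Type u₁) (R : Type u₂) (H : Type u₃) [CommRing k]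
    [Ring R] [Algebra k R] [Ring H] [Algebra k H] where
  s : R →ₐ[k] H
  t : Rᵐᵒᵖ →ₐ[k] H
  s_comm_t : ∀ r r', s r * t (op r') = t (op r') * s r
  γ : H →ₗ[k] BalTensor (rmulBy k fun r => s r) (rmulBy k fun r => t (op r))
  π : H →ₗ[k] R
  γ_s : ∀ r h (x : (γ h).Rep),
    γ (h * s r) = ∑ i, BalTensor.tmul (x.fst i) (x.snd i * s r)
  γ_t : ∀ r h (x : (γ h).Rep),
    γ (h * t (op r)) = ∑ i, BalTensor.tmul (x.fst i * t (op r)) (x.snd i)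
  π_s : ∀ r h, π (h * s r) = π h * r
  π_t : ∀ r h, π (h * t (op r)) = r * π h
  coassoc : ∀ h (x : (γ h).Rep),
    (∑ i, BalTensor₃.left (γ (x.fst i)) (x.snd i) :
      BalTensor₃ (rmulBy k fun r => s r) (rmulBy k fun r => t (op r))
        (rmulBy k fun r => s r) (rmulBy k fun r => t (op r))) =
    ∑ i, BalTensor₃.right (x.fst i) (γ (x.snd i))
  counit_left : ∀ h (x : (γ h).Rep), ∑ i, x.snd i * t (op (π (x.fst i))) = h
  counit_right : ∀ h (x : (γ h).Rep), ∑ i, x.fst i * s (π (x.snd i)) = h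
  takeuchi : ∀ r h (x : (γ h).Rep),
    (∑ i, BalTensor.tmul (s r * x.fst i) (x.snd i) :
      BalTensor (rmulBy k fun r => s r) (rmulBy k fun r => t (op r))) =
    ∑ i, BalTensor.tmul (x.fst i) (t (op r) * x.snd i)
  γ_one : γ 1 = BalTensor.tmul 1 1
  γ_mul : ∀ h h' (x : (γ h).Rep) (x' : (γ h').Rep),
    γ (h * h') = ∑ i, ∑ j, BalTensor.tmul (x.fst i * x'.fst j) (x.snd i * x'.snd j)
  π_one : π 1 = 1
  π_s_mul : ∀ h h', π (s (π h) * h') = π (h * h')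
  π_t_mul : ∀ h h', π (t (op (π h)) * h') = π (h * h')

/-- A Hopf algebroid `(H_L, H_R, S)`: a left and a right bialgebroid on the same total algebra `H`,
and an antipode `S`.  The antipode is not assumed to be bijective. -/
structure HopfAlgebroid (k : Type u₁) (L : Type u₂) (R : Type u₃) (H : Type u₄) [CommRing k]
    [Ring L] [Algebra k L] [Ring R] [Algebra k R] [Ring H] [Algebra k H] where
  /-- the left bialgebroid `H_L` -/
  lb : LeftBialgebroid k L H
  /-- the right bialgebroid `H_R` -/
  rb : RightBialgebroid k R H
  /-- the antipode -/
  S : H →ₗ[k] H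
  sL_πL_tR : ∀ r, lb.s (lb.π (rb.t (op r))) = rb.t (op r)
  tL_πL_sR : ∀ r, lb.t (op (lb.π (rb.s r))) = rb.s r
  sR_πR_tL : ∀ l, rb.s (rb.π (lb.t (op l))) = lb.t (op l)
  tR_πR_sL : ∀ l, rb.t (op (rb.π (lb.s l))) = lb.s l
  /-- `(γ_L ⊗_R H) ∘ γ_R = (H ⊗_L γ_R) ∘ γ_L` in `H ⊗_L H ⊗_R H` -/
  colinear_LR : ∀ h (x : (rb.γ h).Rep) (y : (lb.γ h).Rep),
    (∑ i, BalTensor₃.left (lb.γ (x.fst i)) (x.snd i) :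
      BalTensor₃ (lmulBy k fun l => lb.t (op l)) (lmulBy k fun l => lb.s l)
        (rmulBy k fun r => rb.s r) (rmulBy k fun r => rb.t (op r))) =
    ∑ i, BalTensor₃.right (y.fst i) (rb.γ (y.snd i))
  /-- `(γ_R ⊗_L H) ∘ γ_L = (H ⊗_R γ_L) ∘ γ_R` in `H ⊗_R H ⊗_L H` -/
  colinear_RL : ∀ h (x : (lb.γ h).Rep) (y : (rb.γ h).Rep),
    (∑ i, BalTensor₃.left (rb.γ (x.fst i)) (x.snd i) :
      BalTensor₃ (rmulBy k fun r => rb.s r) (rmulBy k fun r => rb.t (op r))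
        (lmulBy k fun l => lb.t (op l)) (lmulBy k fun l => lb.s l)) =
    ∑ i, BalTensor₃.right (y.fst i) (lb.γ (y.snd i))
  S_tL_tR : ∀ l r h, S (lb.t (op l) * h * rb.t (op r)) = rb.s r * S h * lb.s l
  S_tR_tL : ∀ l r h, S (rb.t (op r) * h * lb.t (op l)) = lb.s l * S h * rb.s r
  antipode_left : ∀ h (x : (lb.γ h).Rep), ∑ i, S (x.fst i) * x.snd i = rb.s (rb.π h)
  antipode_right : ∀ h (x : (rb.γ h).Rep), ∑ i, x.fst i * S (x.snd i) = lb.s (lb.π h)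

/-! ### Comodules and comodule algebras -/

section Hopf

variable {k : Type u₁} {L : Type u₂} {R : Type u₃} {H : Type u₄} [CommRing k]
  [Ring L] [Algebra k L] [Ring R] [Algebra k R] [Ring H] [Algebra k H]

/-- A right comodule of a Hopf algebroid: a right `L`-module and right `R`-module `M` with a right
`H_R`-coaction `ρR : M → M ⊗_R H` and a right `H_L`-coaction `ρL : M → M ⊗_L H`, each a comodule
map for the other. -/
structure HopfAlgebroid.Comodule (𝓗 : HopfAlgebroid k L R H) (M : Type u₅) [AddCommGroup M]
    [Module k M] where
  /-- the right `L`-action -/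
  actL : Lᵐᵒᵖ →ₐ[k] Module.End k M
  /-- the right `R`-action -/
  actR : Rᵐᵒᵖ →ₐ[k] Module.End k M
  ρR : M →ₗ[k] BalTensor (fun r => actR (op r)) (rmulBy k fun r => 𝓗.rb.t (op r))
  ρL : M →ₗ[k] BalTensor (fun l => actL (op l)) (lmulBy k fun l => 𝓗.lb.s l)
  ρR_actR : ∀ r m (x : (ρR m).Rep),
    ρR (actR (op r) m) = ∑ i, BalTensor.tmul (x.fst i) (x.snd i * 𝓗.rb.s r)
  ρR_actL : ∀ l m (x : (ρR m).Rep),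
    ρR (actL (op l) m) = ∑ i, BalTensor.tmul (x.fst i) (𝓗.lb.t (op l) * x.snd i)
  ρL_actL : ∀ l m (x : (ρL m).Rep),
    ρL (actL (op l) m) = ∑ i, BalTensor.tmul (x.fst i) (𝓗.lb.t (op l) * x.snd i)
  ρL_actR : ∀ r m (x : (ρL m).Rep),
    ρL (actR (op r) m) = ∑ i, BalTensor.tmul (x.fst i) (x.snd i * 𝓗.rb.s r)
  counitR : ∀ m (x : (ρR m).Rep), ∑ i, actR (op (𝓗.rb.π (x.snd i))) (x.fst i) = m
  counitL : ∀ m (x : (ρL m).Rep), ∑ i, actL (op (𝓗.lb.π (x.snd i))) (x.fst i) = m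
  coassocR : ∀ m (x : (ρR m).Rep),
    (∑ i, BalTensor₃.left (ρR (x.fst i)) (x.snd i) :
      BalTensor₃ (fun r => actR (op r)) (rmulBy k fun r => 𝓗.rb.t (op r))
        (rmulBy k fun r => 𝓗.rb.s r) (rmulBy k fun r => 𝓗.rb.t (op r))) =
    ∑ i, BalTensor₃.right (x.fst i) (𝓗.rb.γ (x.snd i))
  coassocL : ∀ m (x : (ρL m).Rep),
    (∑ i, BalTensor₃.left (ρL (x.fst i)) (x.snd i) :
      BalTensor₃ (fun l => actL (op l)) (lmulBy k fun l => 𝓗.lb.s l)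
        (lmulBy k fun l => 𝓗.lb.t (op l)) (lmulBy k fun l => 𝓗.lb.s l)) =
    ∑ i, BalTensor₃.right (x.fst i) (𝓗.lb.γ (x.snd i))
  /-- `(M ⊗_R γ_L) ∘ ρR = (ρR ⊗_L H) ∘ ρL` in `M ⊗_R H ⊗_L H` -/
  ρR_colinear : ∀ m (x : (ρR m).Rep) (y : (ρL m).Rep),
    (∑ i, BalTensor₃.right (x.fst i) (𝓗.lb.γ (x.snd i)) :
      BalTensor₃ (fun r => actR (op r)) (rmulBy k fun r => 𝓗.rb.t (op r))
        (lmulBy k fun l => 𝓗.lb.t (op l)) (lmulBy k fun l => 𝓗.lb.s l)) =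
    ∑ i, BalTensor₃.left (ρR (y.fst i)) (y.snd i)
  /-- `(M ⊗_L γ_R) ∘ ρL = (ρL ⊗_R H) ∘ ρR` in `M ⊗_L H ⊗_R H` -/
  ρL_colinear : ∀ m (x : (ρL m).Rep) (y : (ρR m).Rep),
    (∑ i, BalTensor₃.right (x.fst i) (𝓗.rb.γ (x.snd i)) :
      BalTensor₃ (fun l => actL (op l)) (lmulBy k fun l => 𝓗.lb.s l)
        (rmulBy k fun r => 𝓗.rb.s r) (rmulBy k fun r => 𝓗.rb.t (op r))) =
    ∑ i, BalTensor₃.left (ρL (y.fst i)) (y.snd i)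

/-- A right comodule algebra of a Hopf algebroid: an `R`-ring `A`, with unit map `ηR : R → A`,
which is a right comodule, such that unit and multiplication are comodule maps. -/
structure HopfAlgebroid.ComoduleAlgebra (𝓗 : HopfAlgebroid k L R H) (A : Type u₅) [Ring A]
    [Algebra k A] extends 𝓗.Comodule A where
  ηR : R →ₐ[k] A
  actR_eq : ∀ r a, actR (op r) a = a * ηR r
  /-- The left `R`-action of the `R`-ring `A` is the one that the coaction determines: the range
  of `ρR` is in the Takeuchi product. -/
  takeuchi : ∀ r a (x : (ρR a).Rep),
    (∑ i, BalTensor.tmul (ηR r * x.fst i) (x.snd i) :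
      BalTensor (fun r => actR (op r)) (rmulBy k fun r => 𝓗.rb.t (op r))) =
    ∑ i, BalTensor.tmul (x.fst i) (𝓗.rb.t (op r) * x.snd i)
  ρR_one : ρR 1 = BalTensor.tmul 1 1
  ρL_one : ρL 1 = BalTensor.tmul 1 1
  ρR_mul : ∀ a a' (x : (ρR a).Rep) (x' : (ρR a').Rep),
    ρR (a * a') = ∑ i, ∑ j, BalTensor.tmul (x.fst i * x'.fst j) (x.snd i * x'.snd j)
  ρL_mul : ∀ a a' (x : (ρL a).Rep) (x' : (ρL a').Rep),
    ρL (a * a') = ∑ i, ∑ j, BalTensor.tmul (x.fst i * x'.fst j) (x.snd i * x'.snd j)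

namespace HopfAlgebroid.ComoduleAlgebra

variable {𝓗 : HopfAlgebroid k L R H} {A : Type u₅} [Ring A] [Algebra k A]

/-- The subalgebra `B` of `H_R`-coinvariants of `A`. -/
def coinvariants (𝓐 : 𝓗.ComoduleAlgebra A) : Subalgebra k A where
  carrier := {a | 𝓐.ρR a = BalTensor.tmul a 1}
  mul_mem' := by
    intro a b ha hb
    have := 𝓐.ρR_mul a b ⟨1, fun _ => a, fun _ => 1, by simpa using ha⟩
      ⟨1, fun _ => b, fun _ => 1, by simpa using hb⟩
    simpa using this
  add_mem' := by
    intro a b ha hb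
    simp only [Set.mem_ofPred_eq] at *
    simp [ha, hb, ← BalTensor.mk_apply]
  algebraMap_mem' := by
    intro c
    simp only [Set.mem_ofPred_eq, Algebra.algebraMap_eq_smul_one, map_smul, 𝓐.ρR_one]
    simp [← BalTensor.mk_apply]

/-- Right `H`-comodule maps `f : H → A`, where `H` is the regular right comodule: its coactions
are `γ_R` and `γ_L`, its right actions are `h · r = h s_R(r)` and `h · l = t_L(l) h`. -/
structure IsColinear (𝓐 : 𝓗.ComoduleAlgebra A) (f : H →ₗ[k] A) : Prop where
  map_actR : ∀ h r, f (h * 𝓗.rb.s r) = 𝓐.actR (op r) (f h)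
  map_actL : ∀ h l, f (𝓗.lb.t (op l) * h) = 𝓐.actL (op l) (f h)
  map_ρR : ∀ h (x : (𝓗.rb.γ h).Rep), 𝓐.ρR (f h) = ∑ i, BalTensor.tmul (f (x.fst i)) (x.snd i)
  map_ρL : ∀ h (x : (𝓗.lb.γ h).Rep), 𝓐.ρL (f h) = ∑ i, BalTensor.tmul (f (x.fst i)) (x.snd i)

/-- `jc` is the convolution inverse of the left `L`-linear right `R`-linear map `j`, in the
convolution category of `H` and `A`; here `ηL` is the unit map of an `L`-ring structure on `A`. -/
structure IsConvInverse (𝓐 : 𝓗.ComoduleAlgebra A) (ηL : L →ₐ[k] A) (j jc : H →ₗ[k] A) :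
    Prop where
  map_t : ∀ l r h, jc (𝓗.lb.t (op l) * h * 𝓗.rb.t (op r)) = 𝓐.ηR r * jc h * ηL l
  right_inv : ∀ h (x : (𝓗.rb.γ h).Rep), ∑ i, j (x.fst i) * jc (x.snd i) = ηL (𝓗.lb.π h)
  left_inv : ∀ h (x : (𝓗.lb.γ h).Rep), ∑ i, jc (x.fst i) * j (x.snd i) = 𝓐.ηR (𝓗.rb.π h)

/-- `j` is a cleaving map with convolution inverse `jc`. -/
structure IsCleaving (𝓐 : 𝓗.ComoduleAlgebra A) (ηL : L →ₐ[k] A) (j jc : H →ₗ[k] A) :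
    Prop where
  map_sL : ∀ l h, j (𝓗.lb.s l * h) = ηL l * j h
  colinear : 𝓐.IsColinear j
  convInverse : 𝓐.IsConvInverse ηL j jc

/-- The extension `B ⊆ A`, for `B` the subalgebra of coinvariants, is `H`-cleft with respect to
the `L`-ring structure on `A` with unit map `ηL`. -/
structure IsCleft (𝓐 : 𝓗.ComoduleAlgebra A) (ηL : L →ₐ[k] A) : Prop where
  mem_coinvariants : ∀ l, ηL l ∈ 𝓐.coinvariants
  exists_cleaving : ∃ j jc : H →ₗ[k] A, 𝓐.IsCleaving ηL j jc

end HopfAlgebroid.ComoduleAlgebra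

/-! ### Measurings, cocycles and crossed products -/

/-- A measuring of the `L`-ring `ι : L → B` by a left bialgebroid. -/
structure Measuring (𝓛 : LeftBialgebroid k L H) {B : Type u₅} [Ring B] [Algebra k B]
    (ι : L →ₐ[k] B) where
  /-- `h · b` -/
  act : H →ₗ[k] B →ₗ[k] B
  act_one : ∀ h, act h 1 = ι (𝓛.π h)
  act_t : ∀ l h b, act (𝓛.t (op l) * h) b = act h b * ι l
  act_s : ∀ l h b, act (𝓛.s l * h) b = ι l * act h b
  act_mul : ∀ h b b' (x : (𝓛.γ h).Rep),
    act h (b * b') = ∑ i, act (x.fst i) b * act (x.snd i) b'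

/-- A `B`-valued 2-cocycle.  The bilinear map `σ` descends to the tensor product over `Lᵒᵖ` by
`balanced`. -/
structure TwoCocycle {𝓛 : LeftBialgebroid k L H} {B : Type u₅} [Ring B] [Algebra k B]
    {ι : L →ₐ[k] B} (μ : Measuring 𝓛 ι) where
  σ : H →ₗ[k] H →ₗ[k] B
  balanced : ∀ h l h', σ (h * 𝓛.t (op l)) h' = σ h (𝓛.t (op l) * h')
  map_s : ∀ l h h', σ (𝓛.s l * h) h' = ι l * σ h h'
  map_t : ∀ l h h', σ (𝓛.t (op l) * h) h' = σ h h' * ι l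
  act_ι : ∀ h l h' (x : (𝓛.γ h).Rep),
    ∑ i, μ.act (x.fst i) (ι l) * σ (x.snd i) h' = σ h (𝓛.s l * h')
  one_left : ∀ h, σ 1 h = ι (𝓛.π h)
  one_right : ∀ h, σ h 1 = ι (𝓛.π h)
  cocycle : ∀ h h' h'' (x : (𝓛.γ h).Rep) (y : (𝓛.γ h').Rep) (z : (𝓛.γ h'').Rep),
    ∑ i, ∑ p, ∑ q, μ.act (x.fst i) (σ (y.fst p) (z.fst q)) * σ (x.snd i) (y.snd p * z.snd q) =
      ∑ i, ∑ p, σ (x.fst i) (y.fst p) * σ (x.snd i * y.snd p) h''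

namespace TwoCocycle

variable {𝓛 : LeftBialgebroid k L H} {B : Type u₅} [Ring B] [Algebra k B]
  {ι : L →ₐ[k] B} {μ : Measuring 𝓛 ι}

/-- `B` is a `σ`-twisted left module. -/
structure IsTwistedModule (c : TwoCocycle μ) : Prop where
  one_act : ∀ b, μ.act 1 b = b
  twisted : ∀ h h' b (x : (𝓛.γ h).Rep) (y : (𝓛.γ h').Rep),
    ∑ i, ∑ p, μ.act (x.fst i) (μ.act (y.fst p) b) * c.σ (x.snd i) (y.snd p) =
      ∑ i, ∑ p, c.σ (x.fst i) (y.fst p) * μ.act (x.snd i * y.snd p) b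

/-- `τ` is an inverse of the cocycle `σ`. -/
structure IsInverse (c : TwoCocycle μ) (τ : H →ₗ[k] H →ₗ[k] B) : Prop where
  balanced : ∀ h l h', τ (h * 𝓛.s l) h' = τ h (𝓛.s l * h')
  map_s : ∀ l h h', τ (𝓛.s l * h) h' = ι l * τ h h'
  map_t : ∀ l h h', τ (𝓛.t (op l) * h) h' = τ h h' * ι l
  act_ι : ∀ h l h' (x : (𝓛.γ h).Rep),
    ∑ i, τ (x.fst i) h' * μ.act (x.snd i) (ι l) = τ h (𝓛.t (op l) * h')
  σ_mul : ∀ h h' (x : (𝓛.γ h).Rep) (y : (𝓛.γ h').Rep),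
    ∑ i, ∑ p, c.σ (x.fst i) (y.fst p) * τ (x.snd i) (y.snd p) = μ.act h (μ.act h' 1)
  mul_σ : ∀ h h' (x : (𝓛.γ h).Rep) (y : (𝓛.γ h').Rep),
    ∑ i, ∑ p, τ (x.fst i) (y.fst p) * c.σ (x.snd i) (y.snd p) = μ.act (h * h') 1

/-- The cocycle is invertible. -/
def IsInvertible (c : TwoCocycle μ) : Prop := ∃ τ : H →ₗ[k] H →ₗ[k] B, c.IsInverse τ

end TwoCocycle

/-- The `k`-module `B ⊗_L H`, which underlies the crossed products. -/
abbrev CrossedCarrier (𝓛 : LeftBialgebroid k L H) {B : Type u₅} [Ring B] [Algebra k B]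
    (ι : L →ₐ[k] B) : Type (max u₅ u₄) :=
  BalTensor (rmulBy k fun l => ι l) (lmulBy k fun l => 𝓛.s l)

namespace CrossedCarrier

variable {𝓛 : LeftBialgebroid k L H} {B : Type u₅} [Ring B] [Algebra k B] {ι : L →ₐ[k] B}

theorem tmul_ι (b : B) (l : L) (h : H) :
    (BalTensor.tmul (b * ι l) h : CrossedCarrier 𝓛 ι) = BalTensor.tmul b (𝓛.s l * h) :=
  BalTensor.tmul_balanced (a := rmulBy k fun l => ι l) (b := lmulBy k fun l => 𝓛.s l) l b h

/-- The left `B`-action `b (b' ⊗ h) = b b' ⊗ h` on `B ⊗_L H`. -/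
def smulB : B →ₗ[k] CrossedCarrier 𝓛 ι →ₗ[k] CrossedCarrier 𝓛 ι :=
  LinearMap.flip (BalTensor.lift
    (LinearMap.mk₂ k
      (fun b' h => (BalTensor.mk (rmulBy k fun l => ι l) (lmulBy k fun l => 𝓛.s l)).flip h ∘ₗ
        LinearMap.mulRight k b')
      (fun _ _ _ => by ext; simp [mul_add]) (fun _ _ _ => by ext; simp)
      (fun _ _ _ => by ext; simp) (fun _ _ _ => by ext; simp))
    (fun l b' h => by
      ext b
      change (BalTensor.tmul (b * (b' * ι l)) h : CrossedCarrier 𝓛 ι) = _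
      rw [← mul_assoc]
      exact tmul_ι _ _ _))

@[simp] theorem smulB_tmul (b b' : B) (h : H) :
    smulB b (BalTensor.tmul b' h : CrossedCarrier 𝓛 ι) = BalTensor.tmul (b * b') h := by
  simp [smulB, BalTensor.mk_apply]

theorem smulB_mul (b b' : B) (x : CrossedCarrier 𝓛 ι) :
    smulB (b * b') x = smulB b (smulB b' x) := by
  induction x using BalTensor.induction_on with
  | zero => simp
  | tmul m n => simp [mul_assoc]
  | add x y hx hy => simp only [map_add, hx, hy]

end CrossedCarrier

/-- Coassociativity, for a balanced trilinear map out of `H × H × H`. -/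
theorem LeftBialgebroid.coassoc_lift (𝓛 : LeftBialgebroid k L H) {V : Type u₅} [AddCommGroup V]
    [Module k V] (f : H →ₗ[k] H →ₗ[k] H →ₗ[k] V)
    (h₁ : ∀ l x y z, f (𝓛.t (op l) * x) y z = f x (𝓛.s l * y) z)
    (h₂ : ∀ l x y z, f x (𝓛.t (op l) * y) z = f x y (𝓛.s l * z))
    (h : H) (r : (𝓛.γ h).Rep) (u : ∀ i, (𝓛.γ (r.fst i)).Rep) (v : ∀ i, (𝓛.γ (r.snd i)).Rep) :
    ∑ i, ∑ p, f ((u i).fst p) ((u i).snd p) (r.snd i) =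
      ∑ i, ∑ p, f (r.fst i) ((v i).fst p) ((v i).snd p) := by
  let g : BalTensor₃ (lmulBy k fun l => 𝓛.t (op l)) (lmulBy k fun l => 𝓛.s l)
      (lmulBy k fun l => 𝓛.t (op l)) (lmulBy k fun l => 𝓛.s l) →ₗ[k] V :=
    BalTensor₃.lift (TensorProduct.lift
        ((TensorProduct.lift.equiv (RingHom.id k) H H V).toLinearMap ∘ₗ f))
      (fun l x y z => by simpa [lmulBy] using h₁ l x y z)
      (fun l x y z => by simpa [lmulBy] using h₂ l x y z)
  have hg : ∀ x y z, g (BalTensor₃.mkQ _ _ _ _ (x ⊗ₜ[k] (y ⊗ₜ[k] z))) = f x y z :=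
    fun x y z => by simp [g, BalTensor₃.lift_mkQ]
  have := congrArg g (𝓛.coassoc h r)
  rw [map_sum, map_sum] at this
  convert this using 2 with i _ i _
  · refine Eq.trans ?_ ((u i).map_eq (g ∘ₗ BalTensor₃.left.flip (r.snd i))).symm
    simp [hg]
  · refine Eq.trans ?_ ((v i).map_eq (g ∘ₗ BalTensor₃.right (r.fst i))).symm
    simp [hg]

section Crossed

variable {𝓛 : LeftBialgebroid k L H} {B : Type u₅} [Ring B] [Algebra k B]
  {ι : L →ₐ[k] B} {μ : Measuring 𝓛 ι}

open CrossedCarrier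

variable (μ) in
/-- The map `(x ⊗ y, b) ↦ (x · b) ⊗_L y`. -/
def Measuring.actTensorAux : BalTensor (lmulBy k fun l => 𝓛.t (op l)) (lmulBy k fun l => 𝓛.s l)
    →ₗ[k] B →ₗ[k] CrossedCarrier 𝓛 ι :=
  BalTensor.lift
    (LinearMap.mk₂ k
      (fun x y => (BalTensor.mk (rmulBy k fun l => ι l) (lmulBy k fun l => 𝓛.s l)).flip y ∘ₗ
        μ.act x)
      (fun _ _ _ => by ext; simp) (fun _ _ _ => by ext; simp)
      (fun _ _ _ => by ext; simp) (fun _ _ _ => by ext; simp))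
    (fun l x y => by
      ext b
      change (BalTensor.tmul (μ.act (𝓛.t (op l) * x) b) y : CrossedCarrier 𝓛 ι) = _
      rw [μ.act_t]
      exact tmul_ι _ _ _)

variable (μ) in
/-- The map `(h, b) ↦ ∑ (h₍₁₎ · b) ⊗_L h₍₂₎`. -/
def Measuring.actTensor : H →ₗ[k] B →ₗ[k] CrossedCarrier 𝓛 ι := μ.actTensorAux ∘ₗ 𝓛.γ

theorem Measuring.actTensor_rep (h : H) (b : B) (r : (𝓛.γ h).Rep) :
    μ.actTensor h b = ∑ i, BalTensor.tmul (μ.act (r.fst i) b) (r.snd i) := by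
  refine (r.map_eq ((LinearMap.applyₗ b) ∘ₗ μ.actTensorAux)).trans ?_
  simp [BalTensor.mk_apply, actTensorAux]

theorem smulB_actTensor (l : L) (h : H) (b : B) :
    smulB (ι l) (μ.actTensor h b) = μ.actTensor (𝓛.s l * h) b := by
  obtain ⟨r⟩ := BalTensor.nonempty_rep (𝓛.γ h)
  rw [μ.actTensor_rep _ _ r,
    μ.actTensor_rep _ _ ⟨r.n, fun i => 𝓛.s l * r.fst i, r.snd, 𝓛.γ_s l h r⟩]
  simp [μ.act_s]

variable (μ) in
/-- The map `(b ⊗_L h, b') ↦ (b ⊗_L h) (b' ⊗_L 1) = ∑ b (h₍₁₎ · b') ⊗_L h₍₂₎`. -/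
def Measuring.mulB : CrossedCarrier 𝓛 ι →ₗ[k] B →ₗ[k] CrossedCarrier 𝓛 ι :=
  BalTensor.lift
    (LinearMap.mk₂ k (fun b h => smulB b ∘ₗ μ.actTensor h)
      (fun _ _ _ => by ext; simp) (fun _ _ _ => by ext; simp)
      (fun _ _ _ => by ext; simp) (fun _ _ _ => by ext; simp))
    (fun l b h => by
      ext b'
      change smulB (b * ι l) (μ.actTensor h b') = smulB b (μ.actTensor (𝓛.s l * h) b')
      rw [smulB_mul, smulB_actTensor])

theorem Measuring.mulB_tmul (b : B) (h : H) (b' : B) :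
    μ.mulB (BalTensor.tmul b h) b' = smulB b (μ.actTensor h b') := by
  simp [mulB]

theorem Measuring.mulB_smulB (b : B) (x : CrossedCarrier 𝓛 ι) (b' : B) :
    μ.mulB (smulB b x) b' = smulB b (μ.mulB x b') := by
  induction x using BalTensor.induction_on with
  | zero => simp
  | tmul m n => simp [mulB_tmul, smulB_mul]
  | add x y hx hy => simp only [map_add, LinearMap.add_apply, hx, hy]

theorem Measuring.actTensor_mul (h : H) (b b' : B) :
    μ.actTensor h (b * b') = μ.mulB (μ.actTensor h b) b' := by
  obtain ⟨r⟩ := BalTensor.nonempty_rep (𝓛.γ h)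
  have u := fun i => (BalTensor.nonempty_rep (𝓛.γ (r.fst i))).some
  have v := fun i => (BalTensor.nonempty_rep (𝓛.γ (r.snd i))).some
  have key := 𝓛.coassoc_lift
    (LinearMap.mk₂ k (fun x y => BalTensor.mk (rmulBy k fun l => ι l) (lmulBy k fun l => 𝓛.s l)
        (μ.act x b * μ.act y b'))
      (fun _ _ _ => by simp [add_mul]) (fun _ _ _ => by simp)
      (fun _ _ _ => by simp [mul_add]) (fun _ _ _ => by simp))
    (fun l x y z => by simp [μ.act_t, μ.act_s, mul_assoc])
    (fun l x y z => by
      simp only [LinearMap.mk₂_apply, BalTensor.mk_apply, μ.act_t, ← mul_assoc]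
      exact tmul_ι _ _ _) h r u v
  simp only [LinearMap.mk₂_apply, BalTensor.mk_apply] at key
  rw [μ.actTensor_rep _ _ r, μ.actTensor_rep _ _ r]
  simp only [map_sum, LinearMap.sum_apply, mulB_tmul]
  simp only [fun i => μ.actTensor_rep (r.snd i) b' (v i), map_sum, smulB_tmul]
  rw [← key]
  simp only [fun i => μ.act_mul (r.fst i) b b' (u i), ← BalTensor.mk_apply, map_sum,
    LinearMap.sum_apply]

theorem Measuring.mulB_mul (x : CrossedCarrier 𝓛 ι) (b b' : B) :
    μ.mulB x (b * b') = μ.mulB (μ.mulB x b) b' := by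
  induction x using BalTensor.induction_on with
  | zero => simp
  | tmul m n => rw [mulB_tmul, mulB_tmul, mulB_smulB, actTensor_mul]
  | add x y hx hy => simp only [map_add, LinearMap.add_apply, hx, hy]

namespace TwoCocycle

variable (c : TwoCocycle μ)

/-- The map `(x ⊗ y, x', y') ↦ σ(x, x') ⊗_L y y'`. -/
def tensorAux : BalTensor (lmulBy k fun l => 𝓛.t (op l)) (lmulBy k fun l => 𝓛.s l) →ₗ[k]
    H →ₗ[k] H →ₗ[k] CrossedCarrier 𝓛 ι :=
  BalTensor.lift
    (LinearMap.mk₂ k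
      (fun x y => ((BalTensor.mk (rmulBy k fun l => ι l) (lmulBy k fun l => 𝓛.s l)) ∘ₗ
        c.σ x).compl₂ (LinearMap.mulLeft k y))
      (fun _ _ _ => by ext; simp) (fun _ _ _ => by ext; simp)
      (fun _ _ _ => by ext; simp [add_mul]) (fun _ _ _ => by ext; simp))
    (fun l x y => by
      ext x' y'
      change (BalTensor.tmul (c.σ (𝓛.t (op l) * x) x') (y * y') : CrossedCarrier 𝓛 ι) =
        BalTensor.tmul (c.σ x x') (𝓛.s l * y * y')
      rw [c.map_t, mul_assoc]
      exact tmul_ι _ _ _)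

theorem tensorAux_tmul (x y x' y' : H) :
    c.tensorAux (BalTensor.tmul x y) x' y' = BalTensor.tmul (c.σ x x') (y * y') := by
  simp [tensorAux, BalTensor.mk_apply]

theorem tensorAux_balanced (h : H) (l : L) (x' y' : H) :
    c.tensorAux (𝓛.γ h) (𝓛.t (op l) * x') y' = c.tensorAux (𝓛.γ h) x' (𝓛.s l * y') := by
  obtain ⟨r⟩ := BalTensor.nonempty_rep (𝓛.γ h)
  have e := fun u v => r.map_eq (LinearMap.applyₗ v ∘ₗ LinearMap.applyₗ u ∘ₗ c.tensorAux)
  have ht := congrArg (LinearMap.applyₗ y' ∘ₗ LinearMap.applyₗ x' ∘ₗ c.tensorAux)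
    (𝓛.takeuchi l h r)
  simp only [LinearMap.comp_apply, LinearMap.applyₗ_apply_apply, map_sum, tensorAux_tmul,
    c.balanced, mul_assoc] at e ht
  rw [e, e, ht]

/-- The map `x' ⊗ y' ↦ ∑ σ(h₍₁₎, x') ⊗_L h₍₂₎ y'`. -/
def tensorAux₂ (h : H) :
    BalTensor (lmulBy k fun l => 𝓛.t (op l)) (lmulBy k fun l => 𝓛.s l) →ₗ[k]
      CrossedCarrier 𝓛 ι :=
  BalTensor.lift (c.tensorAux (𝓛.γ h)) (fun l => c.tensorAux_balanced h l)

theorem tensorAux₂_tmul (h x' y' : H) :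
    c.tensorAux₂ h (BalTensor.tmul x' y') = c.tensorAux (𝓛.γ h) x' y' :=
  BalTensor.lift_tmul (c.tensorAux (𝓛.γ h)) (fun l => c.tensorAux_balanced h l) x' y'

/-- The map `(h, h') ↦ ∑ σ(h₍₁₎, h'₍₁₎) ⊗_L h₍₂₎ h'₍₂₎`. -/
def tensor : H →ₗ[k] H →ₗ[k] CrossedCarrier 𝓛 ι :=
  LinearMap.mk₂ k (fun h h' => c.tensorAux₂ h (𝓛.γ h'))
    (fun x y h' => by
      induction 𝓛.γ h' using BalTensor.induction_on with
      | zero => simp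
      | tmul m n => simp [tensorAux₂_tmul]
      | add z w hz hw => simp only [map_add] at *; rw [hz, hw]; abel)
    (fun r x h' => by
      induction 𝓛.γ h' using BalTensor.induction_on with
      | zero => simp
      | tmul m n => simp [tensorAux₂_tmul]
      | add z w hz hw => simp only [map_add, smul_add] at *; rw [hz, hw])
    (fun _ _ _ => by simp) (fun _ _ _ => by simp)

theorem tensor_rep (h h' : H) (r : (𝓛.γ h).Rep) (r' : (𝓛.γ h').Rep) :
    c.tensor h h' =
      ∑ i, ∑ j, BalTensor.tmul (c.σ (r.fst i) (r'.fst j)) (r.snd i * r'.snd j) := by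
  have e := fun u v => r.map_eq (LinearMap.applyₗ v ∘ₗ LinearMap.applyₗ u ∘ₗ c.tensorAux)
  simp only [LinearMap.comp_apply, LinearMap.applyₗ_apply_apply, tensorAux_tmul] at e
  refine (r'.map_eq (c.tensorAux₂ h)).trans ?_
  simp only [tensorAux₂_tmul, e]
  exact Finset.sum_comm

theorem smulB_tensor (l : L) (h h' : H) :
    smulB (ι l) (c.tensor h h') = c.tensor (𝓛.s l * h) h' := by
  obtain ⟨r⟩ := BalTensor.nonempty_rep (𝓛.γ h)
  obtain ⟨r'⟩ := BalTensor.nonempty_rep (𝓛.γ h')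
  rw [c.tensor_rep _ _ r r',
    c.tensor_rep _ _ ⟨r.n, fun i => 𝓛.s l * r.fst i, r.snd, 𝓛.γ_s l h r⟩ r']
  simp [c.map_s]

/-- The map `(b ⊗_L h, h') ↦ (b ⊗_L h) (1 ⊗_L h') = ∑ b σ(h₍₁₎, h'₍₁₎) ⊗_L h₍₂₎ h'₍₂₎`. -/
def mulH : CrossedCarrier 𝓛 ι →ₗ[k] H →ₗ[k] CrossedCarrier 𝓛 ι :=
  BalTensor.lift
    (LinearMap.mk₂ k (fun b h => smulB b ∘ₗ c.tensor h)
      (fun _ _ _ => by ext; simp) (fun _ _ _ => by ext; simp)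
      (fun _ _ _ => by ext; simp) (fun _ _ _ => by ext; simp))
    (fun l b h => by
      ext h'
      change smulB (b * ι l) (c.tensor h h') = smulB b (c.tensor (𝓛.s l * h) h')
      rw [smulB_mul, smulB_tensor])

theorem mulH_tmul (b : B) (h h' : H) :
    c.mulH (BalTensor.tmul b h) h' = smulB b (c.tensor h h') := by
  simp [mulH]

theorem mulH_smulB (b : B) (x : CrossedCarrier 𝓛 ι) (h' : H) :
    c.mulH (smulB b x) h' = smulB b (c.mulH x h') := by
  induction x using BalTensor.induction_on with
  | zero => simp
  | tmul m n => simp [mulH_tmul, smulB_mul]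
  | add x y hx hy => simp only [map_add, LinearMap.add_apply, hx, hy]

theorem mulH_actTensor_ι (h : H) (l : L) (h' : H) :
    c.mulH (μ.actTensor h (ι l)) h' = c.tensor h (𝓛.s l * h') := by
  obtain ⟨r⟩ := BalTensor.nonempty_rep (𝓛.γ h)
  obtain ⟨r'⟩ := BalTensor.nonempty_rep (𝓛.γ h')
  have u := fun i => (BalTensor.nonempty_rep (𝓛.γ (r.fst i))).some
  have v := fun i => (BalTensor.nonempty_rep (𝓛.γ (r.snd i))).some
  have key := 𝓛.coassoc_lift
    (LinearMap.mk₂ k (fun x y => ∑ j,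
        BalTensor.mk (rmulBy k fun l => ι l) (lmulBy k fun l => 𝓛.s l)
          (μ.act x (ι l) * c.σ y (r'.fst j)) ∘ₗ LinearMap.mulRight k (r'.snd j))
      (fun _ _ _ => by ext; simp [add_mul, Finset.sum_add_distrib])
      (fun _ _ _ => by ext; simp [Finset.smul_sum])
      (fun _ _ _ => by ext; simp [mul_add, Finset.sum_add_distrib])
      (fun _ _ _ => by ext; simp [Finset.smul_sum]))
    (fun l' x y z => by simp [μ.act_t, c.map_s, mul_assoc])
    (fun l' x y z => by
      simp only [LinearMap.mk₂_apply, LinearMap.sum_apply, LinearMap.comp_apply,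
        LinearMap.mulRight_apply, BalTensor.mk_apply, c.map_t, ← mul_assoc]
      refine Finset.sum_congr rfl fun j _ => ?_
      rw [tmul_ι, mul_assoc]) h r u v
  simp only [LinearMap.mk₂_apply, LinearMap.sum_apply, LinearMap.comp_apply,
    LinearMap.mulRight_apply, BalTensor.mk_apply] at key
  rw [μ.actTensor_rep _ _ r,
    c.tensor_rep _ _ r ⟨r'.n, fun i => 𝓛.s l * r'.fst i, r'.snd, 𝓛.γ_s l h' r'⟩]
  simp only [map_sum, LinearMap.sum_apply, mulH_tmul]
  simp only [fun i => c.tensor_rep (r.snd i) h' (v i) r', map_sum, smulB_tmul]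
  rw [← key]
  refine Finset.sum_congr rfl fun i _ => ?_
  rw [Finset.sum_comm]
  refine Finset.sum_congr rfl fun j _ => ?_
  simp only [← c.act_ι _ l _ (u i), ← BalTensor.mk_apply, map_sum, LinearMap.sum_apply]

theorem mulH_mulB_ι (x : CrossedCarrier 𝓛 ι) (l : L) (h' : H) :
    c.mulH (μ.mulB x (ι l)) h' = c.mulH x (𝓛.s l * h') := by
  induction x using BalTensor.induction_on with
  | zero => simp
  | tmul m n => rw [μ.mulB_tmul, mulH_smulB, mulH_actTensor_ι, mulH_tmul]
  | add x y hx hy => simp only [map_add, LinearMap.add_apply, hx, hy]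

/-- The product of the crossed product,
`(b ⊗_L h) (b' ⊗_L h') = ∑ b (h₍₁₎ · b') σ(h₍₂₎, h'₍₁₎) ⊗_L h₍₃₎ h'₍₂₎`. -/
def mul : CrossedCarrier 𝓛 ι →ₗ[k] CrossedCarrier 𝓛 ι →ₗ[k] CrossedCarrier 𝓛 ι :=
  LinearMap.flip (BalTensor.lift
    (LinearMap.mk₂ k (fun b' h' => c.mulH.flip h' ∘ₗ μ.mulB.flip b')
      (fun _ _ _ => by ext; simp) (fun _ _ _ => by ext; simp)
      (fun _ _ _ => by ext; simp) (fun _ _ _ => by ext; simp))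
    (fun l b' h' => by
      ext x
      change c.mulH (μ.mulB x (b' * ι l)) h' = c.mulH (μ.mulB x b') (𝓛.s l * h')
      rw [μ.mulB_mul, mulH_mulB_ι]))

theorem mul_tmul_tmul (b : B) (h : H) (b' : B) (h' : H) (r : (𝓛.γ h).Rep)
    (v : ∀ i, (𝓛.γ (r.snd i)).Rep) (r' : (𝓛.γ h').Rep) :
    c.mul (BalTensor.tmul b h) (BalTensor.tmul b' h') =
      ∑ i, ∑ p, ∑ j, BalTensor.tmul
        (b * μ.act (r.fst i) b' * c.σ ((v i).fst p) (r'.fst j)) ((v i).snd p * r'.snd j) := by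
  have : c.mul (BalTensor.tmul b h) (BalTensor.tmul b' h') =
      c.mulH (μ.mulB (BalTensor.tmul b h) b') h' := by simp [mul]
  rw [this, μ.mulB_tmul, mulH_smulB, μ.actTensor_rep _ _ r]
  simp only [map_sum, LinearMap.sum_apply, mulH_tmul]
  simp only [fun i => c.tensor_rep (r.snd i) h' (v i) r', map_sum, smulB_tmul, mul_assoc]

/-- The crossed product `B #_σ H` is an associative algebra with unit `1 ⊗_L 1`. -/
structure IsAlgebra : Prop where
  mul_assoc : ∀ x y z, c.mul (c.mul x y) z = c.mul x (c.mul y z)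
  one_mul : ∀ x, c.mul (BalTensor.tmul 1 1) x = x
  mul_one : ∀ x, c.mul x (BalTensor.tmul 1 1) = x

end TwoCocycle

end Crossed

namespace HopfAlgebroid.ComoduleAlgebra

variable {𝓗 : HopfAlgebroid k L R H} {A : Type u₅} [Ring A] [Algebra k A]

/-- The unit map `L → B` of the `L`-ring `B` of coinvariants. -/
def IsCleft.ι {𝓐 : 𝓗.ComoduleAlgebra A} {ηL : L →ₐ[k] A} (h : 𝓐.IsCleft ηL) :
    L →ₐ[k] 𝓐.coinvariants :=
  ηL.codRestrict 𝓐.coinvariants h.mem_coinvariants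

/-- `φ : A → B #_σ H_L` is a left `B`-linear isomorphism of right `H`-comodule algebras, where
`B` is the algebra of coinvariants of `A`.  On `B ⊗_L H` the `H_R`-coaction is `B ⊗_L γ_R`, the
`H_L`-coaction is `B ⊗_L γ_L`, and the right actions of `R` and `L` are
`(b ⊗ h) · r = b ⊗ h s_R(r)` and `(b ⊗ h) · l = b ⊗ t_L(l) h`. -/
structure IsCrossedIso (𝓐 : 𝓗.ComoduleAlgebra A) {ι : L →ₐ[k] 𝓐.coinvariants}
    {μ : Measuring 𝓗.lb ι} (c : TwoCocycle μ) (φ : A ≃ₗ[k] CrossedCarrier 𝓗.lb ι) : Prop where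
  map_one : φ 1 = BalTensor.tmul 1 1
  map_mul : ∀ a a', φ (a * a') = c.mul (φ a) (φ a')
  map_smulB : ∀ (b : 𝓐.coinvariants) (a : A), φ (b * a) = CrossedCarrier.smulB b (φ a)
  map_actR : ∀ r a (x : (φ a).Rep),
    φ (𝓐.actR (op r) a) = ∑ i, BalTensor.tmul (x.fst i) (x.snd i * 𝓗.rb.s r)
  map_actL : ∀ l a (x : (φ a).Rep),
    φ (𝓐.actL (op l) a) = ∑ i, BalTensor.tmul (x.fst i) (𝓗.lb.t (op l) * x.snd i)
  /-- `(φ ⊗_R H) ∘ ρR = (B ⊗_L γ_R) ∘ φ` in `B ⊗_L H ⊗_R H` -/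
  map_ρR : ∀ a (x : (𝓐.ρR a).Rep) (y : (φ a).Rep),
    (∑ i, BalTensor₃.left (φ (x.fst i)) (x.snd i) :
      BalTensor₃ (rmulBy k fun l => ι l) (lmulBy k fun l => 𝓗.lb.s l)
        (rmulBy k fun r => 𝓗.rb.s r) (rmulBy k fun r => 𝓗.rb.t (op r))) =
    ∑ i, BalTensor₃.right (y.fst i) (𝓗.rb.γ (y.snd i))
  /-- `(φ ⊗_L H) ∘ ρL = (B ⊗_L γ_L) ∘ φ` in `B ⊗_L H ⊗_L H` -/
  map_ρL : ∀ a (x : (𝓐.ρL a).Rep) (y : (φ a).Rep),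
    (∑ i, BalTensor₃.left (φ (x.fst i)) (x.snd i) :
      BalTensor₃ (rmulBy k fun l => ι l) (lmulBy k fun l => 𝓗.lb.s l)
        (lmulBy k fun l => 𝓗.lb.t (op l)) (lmulBy k fun l => 𝓗.lb.s l)) =
    ∑ i, BalTensor₃.right (y.fst i) (𝓗.lb.γ (y.snd i))

end HopfAlgebroid.ComoduleAlgebra

end Hopf

/-! Everything is read off from one map, `proj`: $E(a)=a^{(0)}j^c(a^{(1)})$ on $A$. It takes values
in $B$ (`proj_mem`), is left $B$-linear, satisfies $E(a\cdot l)=E(a)\eta_L(l)$, and reconstructs $a$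
from the $\mathcal H_L$-coaction: $E(a_{(0)})j(a_{(1)})=a$ (`sum_proj_mul`). Hence $b\otimes
h\mapsto b\,j(h)$ is bijective, with inverse $a\mapsto E(a_{(0)})\otimes a_{(1)}$.

Since $j$ is colinear and $\varrho_R$ multiplicative, $h\cdot b=E(j(h)b)$ and
$\sigma(h,h')=E(j(h)j(h'))$. The summation axioms all follow one pattern: by left $B$-linearity the
$B$-valued factors move inside a single $E$, reconstruction collapses them, and an identity between
products in $A$ remains. For instance, both sides of the cocycle condition become
$E(j(h)j(h')j(h''))$. Reconstruction likewise makes $b\otimes h\mapsto b\,j(h)$ multiplicative, so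
the algebra axioms of the crossed product are inherited from $A$.

The delicate points are that $E$ lands in $B$ and that $\sigma$ is invertible. No formula for the
coaction on $j^c$ is used; its place is taken by a cancellation principle (`ext_of_conv`): a
suitably $L$-linear map $F$ from a comodule to a right $A$-module is determined by $m\mapsto
F(m_{(0)})j(m_{(1)})$. It is applied with values in $A\otimes_R H$, a right $A$-module through
$\varrho_R$. The inverse of $\sigma$ is $E$ applied to `conv`, $(h,h')\mapsto
j(hh'^{(1)})j^c(h'^{(2)})$. The antipode enters only in `ρL_coinvariant`. -/

section Balanced

variable {k : Type u₁} [CommRing k] {P : Type u₂} {Q : Type u₃}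
  {M : Type u₄} [AddCommGroup M] [Module k M]
  {N : Type u₅} [AddCommGroup N] [Module k N]
  {T : Type u₆} [AddCommGroup T] [Module k T]
  {V : Type u₇} [AddCommGroup V] [Module k V]
  {a : P → Module.End k M} {b : P → Module.End k N}
  {c : Q → Module.End k N} {d : Q → Module.End k T}

/-! ### Evaluating identities in balanced tensor products. -/

namespace BalTensor

theorem lift_rep (f : M →ₗ[k] N →ₗ[k] T) (hf : ∀ p m n, f (a p m) n = f m (b p n))
    {x : BalTensor a b} (r : Rep x) : lift f hf x = ∑ i, f (r.fst i) (r.snd i) := by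
  rw [r.map_eq (lift f hf)]
  simp

/-- The representation of a pure tensor by itself. -/
def Rep.single {x : BalTensor a b} {m : M} {n : N} (h : x = tmul m n) : Rep x :=
  ⟨1, fun _ => m, fun _ => n, by simpa using h⟩

-- A constant sum over `Fin (Rep.single h).n` is simplified to a multiple by `(Rep.single h).n`, as
-- a scalar or as a cast. This lemma and the next remove that factor.
@[simp] theorem Rep.single_n_smul {W : Type*} [AddCommGroup W] {x : BalTensor a b} {m : M}
    {n : N} (h : x = tmul m n) (v : W) :
    (Rep.single h).n • v = v := one_nsmul v

@[simp] theorem Rep.single_n_cast {S : Type*} [NonAssocSemiring S] {x : BalTensor a b}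
    {m : M} {n : N}
    (h : x = tmul m n) : ((Rep.single h).n : S) = 1 := Nat.cast_one

@[simp] theorem Rep.single_fst {x : BalTensor a b} {m : M} {n : N} (h : x = tmul m n)
    (i : Fin (Rep.single h).n) : (Rep.single h).fst i = m := rfl

@[simp] theorem Rep.single_snd {x : BalTensor a b} {m : M} {n : N} (h : x = tmul m n)
    (i : Fin (Rep.single h).n) : (Rep.single h).snd i = n := rfl

/-- The image of a representation under a bilinear map that is balanced, as an identity between
two representations of the same tensor. -/
theorem sum_congr_of_balanced (f : M →ₗ[k] N →ₗ[k] T)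
    (hf : ∀ p m n, f (a p m) n = f m (b p n)) {ι ι' : Type*} [Fintype ι] [Fintype ι']
    {m : ι → M} {n : ι → N} {m' : ι' → M} {n' : ι' → N}
    (h : (∑ i, tmul (m i) (n i) : BalTensor a b) = ∑ i, tmul (m' i) (n' i)) :
    ∑ i, f (m i) (n i) = ∑ i, f (m' i) (n' i) := by
  simpa using congrArg (lift f hf) h

theorem add_tmul (m m' : M) (n : N) :
    (tmul (m + m') n : BalTensor a b) = tmul m n + tmul m' n := by
  simp [← mk_apply]

theorem tmul_add (m : M) (n n' : N) :
    (tmul m (n + n') : BalTensor a b) = tmul m n + tmul m n' := by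
  simp [← mk_apply]

theorem smul_tmul (s : k) (m : M) (n : N) :
    (tmul (s • m) n : BalTensor a b) = s • tmul m n := by
  simp [← mk_apply]

theorem tmul_smul (s : k) (m : M) (n : N) :
    (tmul m (s • n) : BalTensor a b) = s • tmul m n := by
  simp [← mk_apply]

theorem sum_tmul {ι : Type*} (s : Finset ι) (m : ι → M) (n : N) :
    (tmul (∑ i ∈ s, m i) n : BalTensor a b) = ∑ i ∈ s, tmul (m i) n := by
  simp [← mk_apply]

theorem tmul_sum {ι : Type*} (s : Finset ι) (m : M) (n : ι → N) :
    (tmul m (∑ i ∈ s, n i) : BalTensor a b) = ∑ i ∈ s, tmul m (n i) := by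
  simp [← mk_apply]

end BalTensor

/-- An identity in a three-fold tensor product, evaluated by a balanced trilinear map. -/
theorem BalTensor₃.sum_eq_sum {n n' : ℕ} {x : Fin n → BalTensor a b} {t : Fin n → T}
    {m : Fin n' → M} {y : Fin n' → BalTensor c d}
    (e : (∑ i, BalTensor₃.left (x i) (t i) : BalTensor₃ a b c d) =
      ∑ i, BalTensor₃.right (m i) (y i))
    (g : M →ₗ[k] N →ₗ[k] T →ₗ[k] V)
    (h₁ : ∀ p m n t, g (a p m) n t = g m (b p n) t)
    (h₂ : ∀ q m n t, g m (c q n) t = g m n (d q t))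
    {α : Fin n → V} {β : Fin n' → V}
    (hα : ∀ i (r : (x i).Rep), α i = ∑ p, g (r.fst p) (r.snd p) (t i))
    (hβ : ∀ i (r : (y i).Rep), β i = ∑ p, g (m i) (r.fst p) (r.snd p)) :
    ∑ i, α i = ∑ i, β i := by
  -- The trilinear map `g`, as a linear map on the three-fold balanced tensor product.
  let f : BalTensor₃ a b c d →ₗ[k] V :=
    BalTensor₃.lift (TensorProduct.lift
        ((TensorProduct.lift.equiv (RingHom.id k) N T V).toLinearMap ∘ₗ g))
      (fun l x y z => by simpa using h₁ l x y z)
      (fun l x y z => by simpa using h₂ l x y z)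
  have hf : ∀ x y z, f (BalTensor₃.mkQ _ _ _ _ (x ⊗ₜ[k] (y ⊗ₜ[k] z))) = g x y z :=
    fun x y z => by simp [f, BalTensor₃.lift_mkQ]
  have := congrArg f e
  rw [map_sum, map_sum] at this
  convert this using 2 with i _ i _
  · obtain ⟨r⟩ := BalTensor.nonempty_rep (x i)
    rw [hα i r]
    refine Eq.trans ?_ (r.map_eq (f ∘ₗ BalTensor₃.left.flip (t i))).symm
    simp [hf]
  · obtain ⟨r⟩ := BalTensor.nonempty_rep (y i)
    rw [hβ i r]
    refine Eq.trans ?_ (r.map_eq (f ∘ₗ BalTensor₃.right (m i))).symm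
    simp [hf]

end Balanced

/-! ### Consequences of the bialgebroid and antipode axioms. -/

section Hopf

variable {k : Type u₁} {L : Type u₂} {R : Type u₃} {H : Type u₄} [CommRing k]
  [Ring L] [Algebra k L] [Ring R] [Algebra k R] [Ring H] [Algebra k H]

namespace RightBialgebroid

variable (𝓡 : RightBialgebroid k R H)

theorem π_s_apply (r : R) : 𝓡.π (𝓡.s r) = r := by
  simpa [𝓡.π_one] using 𝓡.π_s r 1

theorem π_t_apply (r : R) : 𝓡.π (𝓡.t (op r)) = r := by
  simpa [𝓡.π_one] using 𝓡.π_t r 1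

theorem π_s_mul_eq (r : R) (h : H) : 𝓡.π (𝓡.s r * h) = 𝓡.π (𝓡.t (op r) * h) := by
  rw [← 𝓡.π_t_mul (𝓡.s r) h, π_s_apply]

/-- The axiom `γ_s` concerns right multiplication. At $h=1$ it gives $\gamma(s(r))=1\otimes s(r)$,
and multiplicativity of $\gamma$ then handles left multiplication. -/
theorem γ_s_mul (r : R) (h : H) (x : (𝓡.γ h).Rep) :
    𝓡.γ (𝓡.s r * h) = ∑ i, BalTensor.tmul (x.fst i) (𝓡.s r * x.snd i) := by
  have h1 : 𝓡.γ (𝓡.s r) = BalTensor.tmul 1 (𝓡.s r) := by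
    simpa using 𝓡.γ_s r 1 (BalTensor.Rep.single 𝓡.γ_one)
  simpa using 𝓡.γ_mul _ _ (BalTensor.Rep.single h1) x

theorem γ_t_mul (r : R) (h : H) (x : (𝓡.γ h).Rep) :
    𝓡.γ (𝓡.t (op r) * h) = ∑ i, BalTensor.tmul (𝓡.t (op r) * x.fst i) (x.snd i) := by
  have h1 : 𝓡.γ (𝓡.t (op r)) = BalTensor.tmul (𝓡.t (op r)) 1 := by
    simpa using 𝓡.γ_t r 1 (BalTensor.Rep.single 𝓡.γ_one)
  simpa using 𝓡.γ_mul _ _ (BalTensor.Rep.single h1) x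

end RightBialgebroid

namespace HopfAlgebroid

variable (𝓗 : HopfAlgebroid k L R H)

theorem S_one : 𝓗.S 1 = 1 := by
  simpa [𝓗.lb.π_one] using
    𝓗.antipode_right 1 (BalTensor.Rep.single 𝓗.rb.γ_one)

theorem S_mul_tR (r : R) (h : H) : 𝓗.S (h * 𝓗.rb.t (op r)) = 𝓗.rb.s r * 𝓗.S h := by
  simpa using 𝓗.S_tL_tR 1 r h

/-- Each $t_L(l)$ is in the image of $s_R$, so this is a case of `γ_s_mul`; for $s_L$ the same holds
with $t_R$. -/
theorem γR_tL_mul (l : L) (h : H) (x : (𝓗.rb.γ h).Rep) :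
    𝓗.rb.γ (𝓗.lb.t (op l) * h) =
      ∑ i, BalTensor.tmul (x.fst i) (𝓗.lb.t (op l) * x.snd i) := by
  rw [← 𝓗.sR_πR_tL]
  exact 𝓗.rb.γ_s_mul _ h x

theorem γR_sL_mul (l : L) (h : H) (x : (𝓗.rb.γ h).Rep) :
    𝓗.rb.γ (𝓗.lb.s l * h) =
      ∑ i, BalTensor.tmul (𝓗.lb.s l * x.fst i) (x.snd i) := by
  rw [← 𝓗.tR_πR_sL]
  exact 𝓗.rb.γ_t_mul _ h x

/-! ### Base ring actions and coinvariants of a comodule algebra. -/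

namespace ComoduleAlgebra

variable {𝓗} {A : Type u₅} [Ring A] [Algebra k A] (𝓐 : 𝓗.ComoduleAlgebra A)

/-- The map `a ⊗_R h ↦ a ηR(πR(h))`. -/
def counitMap : BalTensor (fun r => 𝓐.actR (op r)) (rmulBy k fun r => 𝓗.rb.t (op r)) →ₗ[k] A :=
  BalTensor.lift ((LinearMap.mul k A).compl₂ (𝓐.ηR.toLinearMap ∘ₗ 𝓗.rb.π))
    (fun r a h => by simp [rmulBy, 𝓐.actR_eq, 𝓗.rb.π_t, mul_assoc])

theorem counitMap_tmul (a : A) (h : H) :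
    𝓐.counitMap (BalTensor.tmul a h) = a * 𝓐.ηR (𝓗.rb.π h) := by
  simp [counitMap]

theorem sum_mul_ηR_π (a : A) (x : (𝓐.ρR a).Rep) :
    ∑ i, x.fst i * 𝓐.ηR (𝓗.rb.π (x.snd i)) = a := by
  simpa [𝓐.actR_eq] using 𝓐.counitR a x

/-- The right $L$-action is forced by the $R$-ring structure. The counit applied to
$\varrho_R(a\cdot l)=a^{(0)}\otimes t_L(l)a^{(1)}$ returns $a\cdot l$. Since $t_L(l)=s_R(r)$ for
$r=\pi_R(t_L(l))$, the Takeuchi condition turns the same expression into $\eta_R(r)a$. -/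
theorem actL_eq (l : L) (a : A) :
    𝓐.actL (op l) a = 𝓐.ηR (𝓗.rb.π (𝓗.lb.t (op l))) * a := by
  obtain ⟨x⟩ := BalTensor.nonempty_rep (𝓐.ρR a)
  have h1 := 𝓐.sum_mul_ηR_π _ ⟨x.n, x.fst, fun i => 𝓗.lb.t (op l) * x.snd i, 𝓐.ρR_actL l a x⟩
  have h2 := congrArg 𝓐.counitMap (𝓐.takeuchi (𝓗.rb.π (𝓗.lb.t (op l))) a x)
  simp only [map_sum, counitMap_tmul, ← 𝓗.rb.π_s_mul_eq, 𝓗.sR_πR_tL, mul_assoc,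
    ← Finset.mul_sum, sum_mul_ηR_π] at h1 h2
  rw [← h1, ← h2]

theorem mem_coinvariants {a : A} : a ∈ 𝓐.coinvariants ↔ 𝓐.ρR a = BalTensor.tmul a 1 := Iff.rfl

/-- The Takeuchi condition at $\varrho_R(b)=b\otimes 1$ reads $\eta_R(r)b\otimes 1=b\otimes t_R(r)$;
apply the counit. -/
theorem ηR_mul_coinvariant (r : R) {b : A} (hb : b ∈ 𝓐.coinvariants) :
    𝓐.ηR r * b = b * 𝓐.ηR r := by
  have := congrArg 𝓐.counitMap (𝓐.takeuchi r b (BalTensor.Rep.single (𝓐.mem_coinvariants.1 hb)))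
  simpa [counitMap_tmul, 𝓗.rb.π_one, 𝓗.rb.π_t_apply] using this

/-- Apply $a\otimes y\otimes z\mapsto a\otimes yS(z)$ to the compatibility of the two coactions at
$b$. One side is $\varrho_L(b)$, because $\varrho_R(b)=b\otimes 1$. The other is $b_{(0)}\otimes
s_L(\pi_L(b_{(1)}))=b\otimes 1$, by the antipode axiom and the counit. -/
theorem ρL_coinvariant {b : A} (hb : b ∈ 𝓐.coinvariants) :
    𝓐.ρL b = BalTensor.tmul b 1 := by
  obtain ⟨x⟩ := BalTensor.nonempty_rep (𝓐.ρL b)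
  have := BalTensor₃.sum_eq_sum (𝓐.ρL_colinear b x (BalTensor.Rep.single (𝓐.mem_coinvariants.1 hb))).symm
    (LinearMap.mk₂ k (fun a y => BalTensor.mk (fun l => 𝓐.actL (op l))
        (lmulBy k fun l => 𝓗.lb.s l) a ∘ₗ LinearMap.mulLeft k y ∘ₗ 𝓗.S)
      (fun _ _ _ => by ext; simp) (fun _ _ _ => by ext; simp)
      (fun _ _ _ => by ext; simp [add_mul]) (fun _ _ _ => by ext; simp))
    (fun l a y z => by simp [BalTensor.mk_apply, lmulBy, BalTensor.tmul_balanced])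
    (fun r a y z => by simp [rmulBy, S_mul_tR])
    (α := fun _ => 𝓐.ρL b) (β := fun i => BalTensor.tmul (𝓐.actL (op (𝓗.lb.π (x.snd i))) (x.fst i)) 1)
    (fun i r => by simpa [BalTensor.mk_apply, S_one] using r.eq)
    (fun i r => by
      simp [BalTensor.mk_apply, ← BalTensor.tmul_sum, 𝓗.antipode_right _ r,
        BalTensor.tmul_balanced, lmulBy])
  simpa [← BalTensor.sum_tmul, 𝓐.counitL b x] using this

end ComoduleAlgebra
end HopfAlgebroid
end Hopf

namespace HopfAlgebroid.ComoduleAlgebra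

variable {k : Type u₁} {L : Type u₂} {R : Type u₃} {H : Type u₄} [CommRing k]
  [Ring L] [Algebra k L] [Ring R] [Algebra k R] [Ring H] [Algebra k H]
  {𝓗 : HopfAlgebroid k L R H} {A : Type u₅} [Ring A] [Algebra k A]

/-! ### The right $A$-module $A\otimes_R H$. -/

section RightAction

variable (𝓐 : 𝓗.ComoduleAlgebra A)

/-- The tensor product `A ⊗_R H`. -/
abbrev TensorR : Type (max u₅ u₄) :=
  BalTensor (fun r => 𝓐.actR (op r)) (rmulBy k fun r => 𝓗.rb.t (op r))

theorem tmul_ηR (r : R) (a : A) (h : H) :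
    (BalTensor.tmul (a * 𝓐.ηR r) h : 𝓐.TensorR) = BalTensor.tmul a (h * 𝓗.rb.t (op r)) := by
  rw [← 𝓐.actR_eq]
  exact BalTensor.tmul_balanced (a := fun r => 𝓐.actR (op r))
    (b := rmulBy k fun r => 𝓗.rb.t (op r)) r a h

/-- The map `x' ⊗_R y' ↦ x x' ⊗_R y y'`. -/
def tensorMulLeftAux (x : A) (y : H) : 𝓐.TensorR →ₗ[k] 𝓐.TensorR :=
  BalTensor.lift
    ((BalTensor.mk (fun r => 𝓐.actR (op r)) (rmulBy k fun r => 𝓗.rb.t (op r))).compl₁₂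
      (LinearMap.mulLeft k x) (LinearMap.mulLeft k y))
    (fun r x' y' => by
      simp only [LinearMap.compl₁₂_apply, LinearMap.mulLeft_apply, BalTensor.mk_apply, 𝓐.actR_eq,
        rmulBy, LinearMap.mulRight_apply]
      rw [← mul_assoc, ← mul_assoc, tmul_ηR])

@[simp] theorem tensorMulLeftAux_tmul (x x' : A) (y y' : H) :
    𝓐.tensorMulLeftAux x y (BalTensor.tmul x' y') = BalTensor.tmul (x * x') (y * y') := by
  simp [tensorMulLeftAux, BalTensor.mk_apply]

/-- The map `(x, y, x' ⊗_R y') ↦ x x' ⊗_R y y'`. -/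
def tensorMulLeft : A →ₗ[k] H →ₗ[k] 𝓐.TensorR →ₗ[k] 𝓐.TensorR :=
  LinearMap.mk₂ k 𝓐.tensorMulLeftAux
    (fun _ _ _ => BalTensor.hom_ext fun _ _ => by simp [add_mul, BalTensor.add_tmul])
    (fun _ _ _ => BalTensor.hom_ext fun _ _ => by simp [BalTensor.smul_tmul])
    (fun _ _ _ => BalTensor.hom_ext fun _ _ => by simp [add_mul, BalTensor.tmul_add])
    (fun _ _ _ => BalTensor.hom_ext fun _ _ => by simp [BalTensor.tmul_smul])

@[simp] theorem tensorMulLeft_tmul (x x' : A) (y y' : H) :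
    𝓐.tensorMulLeft x y (BalTensor.tmul x' y') = BalTensor.tmul (x * x') (y * y') :=
  𝓐.tensorMulLeftAux_tmul x x' y y'

/-- Factorwise multiplication is not well defined on all of $A\otimes_R H$. It is when the right
factor is some $\varrho_R(a)$, by the Takeuchi condition; this makes `rightAct` balanced. -/
theorem tensorMulLeft_ρR (r : R) (x : A) (y : H) (a : A) :
    𝓐.tensorMulLeft (x * 𝓐.ηR r) y (𝓐.ρR a) =
      𝓐.tensorMulLeft x (y * 𝓗.rb.t (op r)) (𝓐.ρR a) := by
  obtain ⟨z⟩ := BalTensor.nonempty_rep (𝓐.ρR a)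
  have := congrArg (𝓐.tensorMulLeft x y) (𝓐.takeuchi r a z)
  rw [z.map_eq (𝓐.tensorMulLeft (x * 𝓐.ηR r) y),
    z.map_eq (𝓐.tensorMulLeft x (y * 𝓗.rb.t (op r)))]
  simpa [mul_assoc] using this

/-- The right action `(x ⊗_R y) · a = ∑ x a⁽⁰⁾ ⊗_R y a⁽¹⁾` of `A` on `A ⊗_R H`. -/
def rightAct : 𝓐.TensorR →ₗ[k] A →ₗ[k] 𝓐.TensorR :=
  BalTensor.lift (𝓐.tensorMulLeft.compr₂ (LinearMap.lcomp k 𝓐.TensorR 𝓐.ρR))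
    (fun r x y => by
      ext a
      simpa [𝓐.actR_eq, rmulBy] using 𝓐.tensorMulLeft_ρR r x y a)

theorem rightAct_tmul_eq (x : A) (y : H) (a : A) :
    𝓐.rightAct (BalTensor.tmul x y) a = 𝓐.tensorMulLeft x y (𝓐.ρR a) := by
  simp [rightAct]

theorem rightAct_tmul (x : A) (y : H) (a : A) (z : (𝓐.ρR a).Rep) :
    𝓐.rightAct (BalTensor.tmul x y) a =
      ∑ i, BalTensor.tmul (x * z.fst i) (y * z.snd i) := by
  rw [rightAct_tmul_eq, z.map_eq (𝓐.tensorMulLeft x y)]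
  simp

theorem rightAct_ρR (a a' : A) : 𝓐.rightAct (𝓐.ρR a) a' = 𝓐.ρR (a * a') := by
  obtain ⟨x⟩ := BalTensor.nonempty_rep (𝓐.ρR a)
  obtain ⟨x'⟩ := BalTensor.nonempty_rep (𝓐.ρR a')
  rw [𝓐.ρR_mul a a' x x']
  refine (x.map_eq (LinearMap.applyₗ a' ∘ₗ 𝓐.rightAct)).trans ?_
  simp [rightAct_tmul _ _ _ _ x']

theorem rightAct_mul (v : 𝓐.TensorR) (a a' : A) :
    𝓐.rightAct v (a * a') = 𝓐.rightAct (𝓐.rightAct v a) a' := by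
  induction v using BalTensor.induction_on with
  | zero => simp
  | tmul x y =>
    obtain ⟨z⟩ := BalTensor.nonempty_rep (𝓐.ρR a)
    obtain ⟨z'⟩ := BalTensor.nonempty_rep (𝓐.ρR a')
    rw [rightAct_tmul_eq, 𝓐.ρR_mul a a' z z', rightAct_tmul _ _ _ _ z]
    simp [rightAct_tmul _ _ _ _ z', mul_assoc]
  | add v w hv hw => simp only [map_add, LinearMap.add_apply, hv, hw]

theorem rightAct_coinvariant
    (v : 𝓐.TensorR)
    {b : A} (hb : b ∈ 𝓐.coinvariants) (x : v.Rep) :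
    𝓐.rightAct v b = ∑ i, BalTensor.tmul (x.fst i * b) (x.snd i) := by
  refine (x.map_eq (LinearMap.applyₗ b ∘ₗ 𝓐.rightAct)).trans ?_
  simp [rightAct_tmul _ _ _ _ (BalTensor.Rep.single (𝓐.mem_coinvariants.1 hb))]

theorem ρR_coinvariant_mul {b : A} (hb : b ∈ 𝓐.coinvariants) (a : A) (x : (𝓐.ρR a).Rep) :
    𝓐.ρR (b * a) = ∑ i, BalTensor.tmul (b * x.fst i) (x.snd i) := by
  simp [𝓐.ρR_mul b a (BalTensor.Rep.single (𝓐.mem_coinvariants.1 hb)) x]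

theorem ρL_coinvariant_mul {b : A} (hb : b ∈ 𝓐.coinvariants) (a : A) (x : (𝓐.ρL a).Rep) :
    𝓐.ρL (b * a) = ∑ i, BalTensor.tmul (b * x.fst i) (x.snd i) := by
  simp [𝓐.ρL_mul b a (BalTensor.Rep.single (𝓐.ρL_coinvariant hb)) x]

theorem ρR_mul_coinvariant {b : A} (hb : b ∈ 𝓐.coinvariants) (a : A) (x : (𝓐.ρR a).Rep) :
    𝓐.ρR (a * b) = ∑ i, BalTensor.tmul (x.fst i * b) (x.snd i) := by
  simp [𝓐.ρR_mul a b x (BalTensor.Rep.single (𝓐.mem_coinvariants.1 hb))]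

theorem ρL_mul_coinvariant {b : A} (hb : b ∈ 𝓐.coinvariants) (a : A) (x : (𝓐.ρL a).Rep) :
    𝓐.ρL (a * b) = ∑ i, BalTensor.tmul (x.fst i * b) (x.snd i) := by
  simp [𝓐.ρL_mul a b x (BalTensor.Rep.single (𝓐.ρL_coinvariant hb))]

end RightAction

/-! ### Cleaving maps: cancellation and the projection onto the coinvariants. -/

namespace IsCleaving

variable {𝓐 : 𝓗.ComoduleAlgebra A} {ηL : L →ₐ[k] A} {j jc : H →ₗ[k] A}

theorem map_mul_sR (hj : 𝓐.IsCleaving ηL j jc) (h : H) (r : R) :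
    j (h * 𝓗.rb.s r) = j h * 𝓐.ηR r := by
  rw [hj.colinear.map_actR, 𝓐.actR_eq]

theorem map_tL_mul (hj : 𝓐.IsCleaving ηL j jc) (l : L) (h : H) :
    j (𝓗.lb.t (op l) * h) = 𝓐.ηR (𝓗.rb.π (𝓗.lb.t (op l))) * j h := by
  rw [hj.colinear.map_actL, 𝓐.actL_eq]

/-- Left $R$-linearity of $j$ comes from its right $L$-linearity, since $s_R$ takes values in the
image of $t_L$. -/
theorem map_sR_mul (hj : 𝓐.IsCleaving ηL j jc) (r : R) (h : H) :
    j (𝓗.rb.s r * h) = 𝓐.ηR r * j h := by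
  rw [← 𝓗.tL_πL_sR, hj.map_tL_mul, 𝓗.tL_πL_sR, 𝓗.rb.π_s_apply]

theorem inv_tL_mul (hj : 𝓐.IsCleaving ηL j jc) (l : L) (h : H) :
    jc (𝓗.lb.t (op l) * h) = jc h * ηL l := by
  simpa using hj.convInverse.map_t l 1 h

theorem inv_mul_tR (hj : 𝓐.IsCleaving ηL j jc) (h : H) (r : R) :
    jc (h * 𝓗.rb.t (op r)) = 𝓐.ηR r * jc h := by
  simpa using hj.convInverse.map_t 1 r h

/-- Frees the colinearity axiom from `Fin`-indexed representations, so that sums over products of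
index types can be used. -/
theorem ρR_map_of_eq_sum (hj : 𝓐.IsCleaving ηL j jc) {h : H} {ι : Type*} [Fintype ι]
    {f g : ι → H}
    (e : 𝓗.rb.γ h = ∑ i, BalTensor.tmul (f i) (g i)) :
    𝓐.ρR (j h) = ∑ i, BalTensor.tmul (j (f i)) (g i) := by
  obtain ⟨x⟩ := BalTensor.nonempty_rep (𝓗.rb.γ h)
  rw [hj.colinear.map_ρR h x]
  exact BalTensor.sum_congr_of_balanced
    (BalTensor.mk (fun r => 𝓐.actR (op r)) (rmulBy k fun r => 𝓗.rb.t (op r)) ∘ₗ j)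
    (fun r h h' => by
      simpa [rmulBy, BalTensor.mk_apply, hj.map_mul_sR] using 𝓐.tmul_ηR r (j h) h')
    (x.eq.symm.trans e)

/-- A map `F` from a comodule to a right `A`-module is determined by its convolution product
with a cleaving map. -/
theorem eq_sum_of_conv (hj : 𝓐.IsCleaving ηL j jc)
    {M : Type u₆} [AddCommGroup M] [Module k M] {aL : L → Module.End k M} {aR : R → Module.End k M}
    {ρL : M →ₗ[k] BalTensor aL (lmulBy k fun l => 𝓗.lb.s l)}
    {ρR : M →ₗ[k] BalTensor aR (rmulBy k fun r => 𝓗.rb.t (op r))}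
    (colinear : ∀ m (x : (ρL m).Rep) (y : (ρR m).Rep),
      (∑ i, BalTensor₃.left (ρL (y.fst i)) (y.snd i) :
        BalTensor₃ aL (lmulBy k fun l => 𝓗.lb.s l)
          (rmulBy k fun r => 𝓗.rb.s r) (rmulBy k fun r => 𝓗.rb.t (op r))) =
      ∑ i, BalTensor₃.right (x.fst i) (𝓗.rb.γ (x.snd i)))
    (counit : ∀ m (x : (ρL m).Rep), ∑ i, aL (𝓗.lb.π (x.snd i)) (x.fst i) = m)
    {V : Type u₇} [AddCommGroup V] [Module k V] (act : V →ₗ[k] A →ₗ[k] V)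
    (act_mul : ∀ v a a', act v (a * a') = act (act v a) a')
    (F : M →ₗ[k] V) (hF : ∀ l m, F (aL l m) = act (F m) (ηL l))
    (K : M → V) (hK : ∀ m (x : (ρL m).Rep), K m = ∑ i, act (F (x.fst i)) (j (x.snd i)))
    (m : M) (y : (ρR m).Rep) : F m = ∑ i, act (K (y.fst i)) (jc (y.snd i)) := by
  obtain ⟨x⟩ := BalTensor.nonempty_rep (ρL m)
  -- Evaluate $F(m)\,j(h)\,j^c(h')$ on the two bracketings. One groups $F$ with $j$ into $K$; the
  -- other contracts $j$ with $j^c$ to $\eta_L\pi_L$, which the counit absorbs.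
  have := BalTensor₃.sum_eq_sum (colinear m x y)
    ((act.compl₁₂ F j).compr₂ (act.compl₂ jc))
    (fun l m h h' => by simp [hF, lmulBy, hj.map_sL, act_mul])
    (fun r m h h' => by simp [rmulBy, hj.map_mul_sR, hj.inv_mul_tR, act_mul])
    (α := fun i => act (K (y.fst i)) (jc (y.snd i)))
    (β := fun i => act (F (x.fst i)) (ηL (𝓗.lb.π (x.snd i))))
    (fun i r => by simp [hK _ r])
    (fun i r => by simp [← act_mul, ← hj.convInverse.right_inv _ r])
  rw [this]
  simp only [← hF, ← map_sum, counit]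

/-- Two maps from a comodule to a right `A`-module agree if their convolution products with a
cleaving map do. -/
theorem ext_of_conv (hj : 𝓐.IsCleaving ηL j jc)
    {M : Type u₆} [AddCommGroup M] [Module k M] {aL : L → Module.End k M} {aR : R → Module.End k M}
    {ρL : M →ₗ[k] BalTensor aL (lmulBy k fun l => 𝓗.lb.s l)}
    {ρR : M →ₗ[k] BalTensor aR (rmulBy k fun r => 𝓗.rb.t (op r))}
    (colinear : ∀ m (x : (ρL m).Rep) (y : (ρR m).Rep),
      (∑ i, BalTensor₃.left (ρL (y.fst i)) (y.snd i) :
        BalTensor₃ aL (lmulBy k fun l => 𝓗.lb.s l)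
          (rmulBy k fun r => 𝓗.rb.s r) (rmulBy k fun r => 𝓗.rb.t (op r))) =
      ∑ i, BalTensor₃.right (x.fst i) (𝓗.rb.γ (x.snd i)))
    (counit : ∀ m (x : (ρL m).Rep), ∑ i, aL (𝓗.lb.π (x.snd i)) (x.fst i) = m)
    {V : Type u₇} [AddCommGroup V] [Module k V] (act : V →ₗ[k] A →ₗ[k] V)
    (act_mul : ∀ v a a', act v (a * a') = act (act v a) a')
    (F G : M →ₗ[k] V) (hF : ∀ l m, F (aL l m) = act (F m) (ηL l))
    (hG : ∀ l m, G (aL l m) = act (G m) (ηL l))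
    (K : M → V) (hKF : ∀ m (x : (ρL m).Rep), K m = ∑ i, act (F (x.fst i)) (j (x.snd i)))
    (hKG : ∀ m (x : (ρL m).Rep), K m = ∑ i, act (G (x.fst i)) (j (x.snd i)))
    (m : M) : F m = G m := by
  obtain ⟨y⟩ := BalTensor.nonempty_rep (ρR m)
  rw [hj.eq_sum_of_conv colinear counit act act_mul F hF K hKF m y,
    hj.eq_sum_of_conv colinear counit act act_mul G hG K hKG m y]

/-- The map `a ⊗_R h ↦ a jᶜ(h)`. -/
def projAux (hj : 𝓐.IsCleaving ηL j jc) : 𝓐.TensorR →ₗ[k] A :=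
  BalTensor.lift ((LinearMap.mul k A).compl₂ jc)
    (fun r a h => by simp [rmulBy, 𝓐.actR_eq, hj.inv_mul_tR, mul_assoc])

/-- The map `a ↦ ∑ a⁽⁰⁾ jᶜ(a⁽¹⁾)`, a projection onto the coinvariants if `j` is normalised. -/
def proj (hj : 𝓐.IsCleaving ηL j jc) : A →ₗ[k] A := hj.projAux ∘ₗ 𝓐.ρR

theorem proj_rep (hj : 𝓐.IsCleaving ηL j jc) {a : A} (x : (𝓐.ρR a).Rep) :
    hj.proj a = ∑ i, x.fst i * jc (x.snd i) := by
  refine (x.map_eq hj.projAux).trans ?_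
  simp [projAux]

theorem proj_of_eq_sum (hj : 𝓐.IsCleaving ηL j jc) {a : A} {ι : Type*} [Fintype ι]
    {f : ι → A} {g : ι → H} (e : 𝓐.ρR a = ∑ i, BalTensor.tmul (f i) (g i)) :
    hj.proj a = ∑ i, f i * jc (g i) := by
  simp [proj, e, projAux]

theorem proj_actL (hj : 𝓐.IsCleaving ηL j jc) (l : L) (a : A) :
    hj.proj (𝓐.actL (op l) a) = hj.proj a * ηL l := by
  obtain ⟨x⟩ := BalTensor.nonempty_rep (𝓐.ρR a)
  rw [hj.proj_rep ⟨x.n, x.fst, _, 𝓐.ρR_actL l a x⟩, hj.proj_rep x]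
  simp [hj.inv_tL_mul, mul_assoc, Finset.sum_mul]

/-- Colinearity of $\varrho_R$ moves the $\mathcal H_L$-coproduct onto the second leg:
$E(a_{(0)})j(a_{(1)})=a^{(0)}j^c(a^{(1)}{}_{(1)})j(a^{(1)}{}_{(2)})=a^{(0)}\eta_R(\pi_R(a^{(1)}))=a$.
-/
theorem sum_proj_mul (hj : 𝓐.IsCleaving ηL j jc) {a : A} (x : (𝓐.ρL a).Rep) :
    ∑ i, hj.proj (x.fst i) * j (x.snd i) = a := by
  obtain ⟨y⟩ := BalTensor.nonempty_rep (𝓐.ρR a)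
  have := BalTensor₃.sum_eq_sum (𝓐.ρR_colinear a y x).symm
    (((LinearMap.mul k A).compl₂ jc).compr₂ ((LinearMap.mul k A).compl₂ j))
    (fun r m h h' => by simp [rmulBy, 𝓐.actR_eq, hj.inv_mul_tR, mul_assoc])
    (fun l m h h' => by simp [lmulBy, hj.inv_tL_mul, hj.map_sL, mul_assoc])
    (α := fun i => hj.proj (x.fst i) * j (x.snd i))
    (β := fun i => y.fst i * 𝓐.ηR (𝓗.rb.π (y.snd i)))
    (fun i r => by simp [hj.proj_rep r, Finset.sum_mul])
    (fun i r => by simp [mul_assoc, ← Finset.mul_sum, hj.convInverse.left_inv _ r])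
  rw [this, 𝓐.sum_mul_ηR_π]

theorem sum_proj_mul_of_eq_sum (hj : 𝓐.IsCleaving ηL j jc) {a : A} {ι : Type*} [Fintype ι]
    {f : ι → A} {g : ι → H} (e : 𝓐.ρL a = ∑ i, BalTensor.tmul (f i) (g i)) :
    ∑ i, hj.proj (f i) * j (g i) = a := by
  obtain ⟨x⟩ := BalTensor.nonempty_rep (𝓐.ρL a)
  refine Eq.trans ?_ (hj.sum_proj_mul x)
  exact BalTensor.sum_congr_of_balanced ((LinearMap.mul k A).compl₁₂ hj.proj j)
    (fun l a h => by simp [lmulBy, hj.proj_actL, hj.map_sL, mul_assoc]) (e.symm.trans x.eq)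

/-- Cancellation applied to $\varrho_R\circ E$ and $a\mapsto E(a)\otimes 1$. Both become $\varrho_R$
after convolution with $j$: the first because $\varrho_R$ is right $A$-linear, the second because
$E(a_{(0)})j(a_{(1)}{}^{(1)})\otimes a_{(1)}{}^{(2)}=E(a^{(0)}{}_{(0)})j(a^{(0)}{}_{(1)})\otimes
a^{(1)}$. -/
theorem proj_mem (hj : 𝓐.IsCleaving ηL j jc) (hηL : ∀ l, ηL l ∈ 𝓐.coinvariants) (a : A) :
    hj.proj a ∈ 𝓐.coinvariants := by
  refine hj.ext_of_conv (aL := fun l => 𝓐.actL (op l)) (aR := fun r => 𝓐.actR (op r))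
    (ρL := 𝓐.ρL) (ρR := 𝓐.ρR) (fun m x y => (𝓐.ρL_colinear m x y).symm) 𝓐.counitL
    𝓐.rightAct 𝓐.rightAct_mul (𝓐.ρR ∘ₗ hj.proj)
    ((BalTensor.mk (fun r => 𝓐.actR (op r)) (rmulBy k fun r => 𝓗.rb.t (op r))).flip 1 ∘ₗ hj.proj)
    (fun l m => ?_) (fun l m => ?_) 𝓐.ρR (fun m x => ?_) (fun m x => ?_) a
  · simp [hj.proj_actL, 𝓐.rightAct_ρR]
  · simp [hj.proj_actL, BalTensor.mk_apply,
      𝓐.rightAct_coinvariant _ (hηL l) (BalTensor.Rep.single rfl)]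
  · simp [𝓐.rightAct_ρR, ← map_sum, hj.sum_proj_mul]
  · obtain ⟨y⟩ := BalTensor.nonempty_rep (𝓐.ρR m)
    have := BalTensor₃.sum_eq_sum (𝓐.ρL_colinear m x y).symm
      (((LinearMap.mul k A).compl₁₂ hj.proj j).compr₂
        (BalTensor.mk (fun r => 𝓐.actR (op r)) (rmulBy k fun r => 𝓗.rb.t (op r))))
      (fun l m h h' => by simp [lmulBy, hj.proj_actL, hj.map_sL, mul_assoc])
      (fun r m h h' => by simp [rmulBy, hj.map_mul_sR, ← mul_assoc, BalTensor.mk_apply, 𝓐.tmul_ηR])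
      (α := fun i => BalTensor.tmul (y.fst i) (y.snd i))
      (β := fun i => 𝓐.rightAct (BalTensor.tmul (hj.proj (x.fst i)) 1) (j (x.snd i)))
      (fun i r => by simp [BalTensor.mk_apply, ← BalTensor.sum_tmul, hj.sum_proj_mul r])
      (fun i r => by
        rw [𝓐.rightAct_tmul _ _ _ ⟨r.n, _, _, hj.colinear.map_ρR _ r⟩]
        simp [BalTensor.mk_apply])
    simpa [BalTensor.mk_apply, ← this] using y.eq

theorem proj_coinvariant_mul (hj : 𝓐.IsCleaving ηL j jc) {b : A} (hb : b ∈ 𝓐.coinvariants)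
    (a : A) : hj.proj (b * a) = b * hj.proj a := by
  obtain ⟨x⟩ := BalTensor.nonempty_rep (𝓐.ρR a)
  rw [hj.proj_rep ⟨x.n, _, _, 𝓐.ρR_coinvariant_mul hb a x⟩, hj.proj_rep x]
  simp [mul_assoc, Finset.mul_sum]

theorem proj_map (hj : 𝓐.IsCleaving ηL j jc) (h : H) : hj.proj (j h) = ηL (𝓗.lb.π h) := by
  obtain ⟨x⟩ := BalTensor.nonempty_rep (𝓗.rb.γ h)
  rw [hj.proj_rep ⟨x.n, _, _, hj.colinear.map_ρR h x⟩, ← hj.convInverse.right_inv h x]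

theorem proj_one (hj : 𝓐.IsCleaving ηL j jc) : hj.proj 1 = jc 1 := by
  simp [hj.proj_rep (BalTensor.Rep.single 𝓐.ρR_one)]

/-! ### The map `conv`, from which the inverse of the cocycle is built. -/

/-- The map `h' ↦ ∑ j(h h'⁽¹⁾) jᶜ(h'⁽²⁾)`, for fixed `h`. -/
def convAux (hj : 𝓐.IsCleaving ηL j jc) (h : H) : H →ₗ[k] A :=
  BalTensor.lift ((LinearMap.mul k A).compl₁₂ (j ∘ₗ LinearMap.mulLeft k h) jc)
    (fun r x y => by simp [rmulBy, ← mul_assoc, hj.map_mul_sR, hj.inv_mul_tR]) ∘ₗ 𝓗.rb.γ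

theorem convAux_rep (hj : 𝓐.IsCleaving ηL j jc) (h : H) {h' : H} (x : (𝓗.rb.γ h').Rep) :
    hj.convAux h h' = ∑ i, j (h * x.fst i) * jc (x.snd i) := by
  simp [convAux, BalTensor.lift_rep _ _ x]

/-- The map `(h, h') ↦ ∑ j(h h'⁽¹⁾) jᶜ(h'⁽²⁾)`. -/
def conv (hj : 𝓐.IsCleaving ηL j jc) : H →ₗ[k] H →ₗ[k] A :=
  LinearMap.mk₂ k (fun h h' => hj.convAux h h')
    (fun _ _ h' => by
      obtain ⟨x⟩ := BalTensor.nonempty_rep (𝓗.rb.γ h')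
      simp [hj.convAux_rep _ x, add_mul, Finset.sum_add_distrib])
    (fun _ _ h' => by
      obtain ⟨x⟩ := BalTensor.nonempty_rep (𝓗.rb.γ h')
      simp [hj.convAux_rep _ x, Finset.smul_sum])
    (fun _ _ _ => by simp) (fun _ _ _ => by simp)

theorem conv_rep (hj : 𝓐.IsCleaving ηL j jc) (h : H) {h' : H} (x : (𝓗.rb.γ h').Rep) :
    hj.conv h h' = ∑ i, j (h * x.fst i) * jc (x.snd i) :=
  hj.convAux_rep h x

theorem conv_sL_mul (hj : 𝓐.IsCleaving ηL j jc) (l : L) (h h' : H) :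
    hj.conv (𝓗.lb.s l * h) h' = ηL l * hj.conv h h' := by
  obtain ⟨x⟩ := BalTensor.nonempty_rep (𝓗.rb.γ h')
  simp [hj.conv_rep _ x, mul_assoc, hj.map_sL, Finset.mul_sum]

theorem conv_tL_mul (hj : 𝓐.IsCleaving ηL j jc) (l : L) (h h' : H) :
    hj.conv (𝓗.lb.t (op l) * h) h' = 𝓐.actL (op l) (hj.conv h h') := by
  obtain ⟨x⟩ := BalTensor.nonempty_rep (𝓗.rb.γ h')
  simp [hj.conv_rep _ x, mul_assoc, hj.map_tL_mul, 𝓐.actL_eq, Finset.mul_sum]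

theorem conv_mul_sL (hj : 𝓐.IsCleaving ηL j jc) (l : L) (h h' : H) :
    hj.conv (h * 𝓗.lb.s l) h' = hj.conv h (𝓗.lb.s l * h') := by
  obtain ⟨x⟩ := BalTensor.nonempty_rep (𝓗.rb.γ h')
  rw [hj.conv_rep _ x, hj.conv_rep h ⟨x.n, _, _, 𝓗.γR_sL_mul l h' x⟩]
  simp [mul_assoc]

theorem conv_right_tL_mul (hj : 𝓐.IsCleaving ηL j jc) (l : L) (h h' : H) :
    hj.conv h (𝓗.lb.t (op l) * h') = hj.conv h h' * ηL l := by
  obtain ⟨x⟩ := BalTensor.nonempty_rep (𝓗.rb.γ h')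
  rw [hj.conv_rep h ⟨x.n, _, _, 𝓗.γR_tL_mul l h' x⟩, hj.conv_rep _ x]
  simp [hj.inv_tL_mul, mul_assoc, Finset.sum_mul]

/-- This characterises `conv`: by construction it is $j(h\,\cdot)$ convolved with $j^c$, and
convolving with $j$ undoes that. -/
theorem sum_conv_mul (hj : 𝓐.IsCleaving ηL j jc) (h : H) {h' : H} (x : (𝓗.lb.γ h').Rep) :
    ∑ i, hj.conv h (x.fst i) * j (x.snd i) = j (h * h') := by
  obtain ⟨y⟩ := BalTensor.nonempty_rep (𝓗.rb.γ h')
  have := BalTensor₃.sum_eq_sum (𝓗.colinear_RL h' x y)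
    (((LinearMap.mul k A).compl₁₂ (j ∘ₗ LinearMap.mulLeft k h) jc).compr₂
      ((LinearMap.mul k A).compl₂ j))
    (fun r x y z => by simp [rmulBy, ← mul_assoc, hj.map_mul_sR, hj.inv_mul_tR])
    (fun l x y z => by simp [lmulBy, hj.inv_tL_mul, hj.map_sL, mul_assoc])
    (α := fun i => hj.conv h (x.fst i) * j (x.snd i))
    (β := fun i => j (h * (y.fst i * 𝓗.rb.s (𝓗.rb.π (y.snd i)))))
    (fun i r => by simp [hj.conv_rep _ r, Finset.sum_mul])
    (fun i r => by
      simp [← mul_assoc, hj.map_mul_sR, ← hj.convInverse.left_inv _ r, Finset.mul_sum])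
  rw [this, ← map_sum, ← Finset.mul_sum, 𝓗.rb.counit_right]

/-- The cancellation property `ext_of_conv` for the regular comodule. -/
theorem ext_of_conv_regular (hj : 𝓐.IsCleaving ηL j jc)
    {V : Type u₇} [AddCommGroup V] [Module k V] (act : V →ₗ[k] A →ₗ[k] V)
    (act_mul : ∀ v a a', act v (a * a') = act (act v a) a')
    (F G : H →ₗ[k] V) (hF : ∀ l m, F (𝓗.lb.t (op l) * m) = act (F m) (ηL l))
    (hG : ∀ l m, G (𝓗.lb.t (op l) * m) = act (G m) (ηL l))
    (K : H → V) (hKF : ∀ m (x : (𝓗.lb.γ m).Rep), K m = ∑ i, act (F (x.fst i)) (j (x.snd i)))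
    (hKG : ∀ m (x : (𝓗.lb.γ m).Rep), K m = ∑ i, act (G (x.fst i)) (j (x.snd i)))
    (m : H) : F m = G m :=
  hj.ext_of_conv (fun m x y => 𝓗.colinear_LR m y x)
    (fun m x => by simpa [lmulBy] using 𝓗.lb.counit_right m x) act act_mul F G hF hG K hKF hKG m

/-- By cancellation in $h'$: convolved with $j$, both sides give $j(h\,s_R(r)\,h')$. -/
theorem conv_mul_sR (hj : 𝓐.IsCleaving ηL j jc) (hηL : ∀ l, ηL l ∈ 𝓐.coinvariants) (r : R)
    (h h' : H) : hj.conv (h * 𝓗.rb.s r) h' = hj.conv h h' * 𝓐.ηR r := by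
  refine hj.ext_of_conv_regular (LinearMap.mul k A) (fun _ _ _ => (mul_assoc _ _ _).symm)
    (hj.conv (h * 𝓗.rb.s r)) (LinearMap.mulRight k (𝓐.ηR r) ∘ₗ hj.conv h)
    (fun l m => ?_) (fun l m => ?_) (fun m => j (h * 𝓗.rb.s r * m)) (fun m x => ?_)
    (fun m x => ?_) h'
  · simp [hj.conv_right_tL_mul]
  · simp [hj.conv_right_tL_mul, mul_assoc, 𝓐.ηR_mul_coinvariant r (hηL l)]
  · simp [hj.sum_conv_mul]
  -- As $s_R(r)$ is a value of $t_L$, $\gamma_L(s_R(r)m)=m_{(1)}\otimes s_R(r)m_{(2)}$.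
  · have e := 𝓗.lb.γ_t (𝓗.lb.π (𝓗.rb.s r)) m x
    rw [𝓗.tL_πL_sR] at e
    rw [mul_assoc, ← hj.sum_conv_mul h ⟨x.n, _, _, e⟩]
    simp [hj.map_sR_mul, mul_assoc]

/-- Colinearity in the first variable, by cancellation in the second: both sides convolve with $j$
to $\varrho_R(j(hm))$. -/
theorem ρR_conv (hj : 𝓐.IsCleaving ηL j jc) (hηL : ∀ l, ηL l ∈ 𝓐.coinvariants) (h h' : H)
    (x : (𝓗.rb.γ h).Rep) :
    𝓐.ρR (hj.conv h h') = ∑ i, BalTensor.tmul (hj.conv (x.fst i) h') (x.snd i) := by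
  have key := hj.ext_of_conv_regular 𝓐.rightAct 𝓐.rightAct_mul (𝓐.ρR ∘ₗ hj.conv h)
    (∑ i, (BalTensor.mk (fun r => 𝓐.actR (op r)) (rmulBy k fun r => 𝓗.rb.t (op r))).flip
      (x.snd i) ∘ₗ hj.conv (x.fst i))
    (fun l m => ?_) (fun l m => ?_) (fun m => 𝓐.ρR (j (h * m))) (fun m y => ?_)
    (fun m y => ?_) h'
  · simpa [BalTensor.mk_apply] using key
  · simp [hj.conv_right_tL_mul, 𝓐.rightAct_ρR]
  · simp [hj.conv_right_tL_mul, BalTensor.mk_apply,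
      𝓐.rightAct_coinvariant _ (hηL l) (BalTensor.Rep.single rfl)]
  · simp [𝓐.rightAct_ρR, ← map_sum, hj.sum_conv_mul]
  · obtain ⟨z⟩ := BalTensor.nonempty_rep (𝓗.rb.γ m)
    have := fun i => BalTensor₃.sum_eq_sum (𝓗.colinear_LR m z y)
      (((LinearMap.mul k A).compl₁₂ (hj.conv (x.fst i)) j).compr₂
        ((BalTensor.mk (fun r => 𝓐.actR (op r)) (rmulBy k fun r => 𝓗.rb.t (op r))).compl₂
          (LinearMap.mulLeft k (x.snd i))))
      (fun l m h h' => by simp [lmulBy, hj.conv_right_tL_mul, hj.map_sL, mul_assoc])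
      (fun r m h h' => by simp [rmulBy, hj.map_mul_sR, ← mul_assoc, BalTensor.mk_apply, 𝓐.tmul_ηR])
      (α := fun p => BalTensor.tmul (j (x.fst i * z.fst p)) (x.snd i * z.snd p))
      (β := fun p => 𝓐.rightAct (BalTensor.tmul (hj.conv (x.fst i) (y.fst p)) (x.snd i))
        (j (y.snd p)))
      (fun p r => by simp [BalTensor.mk_apply, ← BalTensor.sum_tmul, hj.sum_conv_mul _ r])
      (fun p r => by
        rw [𝓐.rightAct_tmul _ _ _ ⟨r.n, _, _, hj.colinear.map_ρR _ r⟩]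
        simp [BalTensor.mk_apply])
    -- The double sum is indexed by pairs so that `ρR_map_of_eq_sum` applies to $\gamma_R(hm)$.
    have e := 𝓗.rb.γ_mul h m x z
    rw [← Fintype.sum_prod_type'] at e
    rw [hj.ρR_map_of_eq_sum e, Fintype.sum_prod_type]
    simp only [this, LinearMap.sum_apply, map_sum]
    exact Finset.sum_comm

end IsCleaving
end HopfAlgebroid.ComoduleAlgebra

namespace HopfAlgebroid.ComoduleAlgebra

variable {k : Type u₁} {L : Type u₂} {R : Type u₃} {H : Type u₄} [CommRing k]
  [Ring L] [Algebra k L] [Ring R] [Algebra k R] [Ring H] [Algebra k H]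
  {𝓗 : HopfAlgebroid k L R H} {A : Type u₅} [Ring A] [Algebra k A]
  {𝓐 : 𝓗.ComoduleAlgebra A} {ηL : L →ₐ[k] A} {j jc : H →ₗ[k] A}

/-! ### Reconstruction identities for products of values of $j$. -/

namespace IsCleaving

/-- Reconstruction for `conv`, using only its $\mathcal H_R$-coaction: the sum equals `conv` of
$h^{(1)}$ and $h'$ times $j^c(h^{(2)}{}_{(1)})j(h^{(2)}{}_{(2)})=\eta_R(\pi_R(h^{(2)}))$, and the
counit of $\mathcal H_R$ recombines $h$. -/
theorem sum_proj_conv_mul (hj : 𝓐.IsCleaving ηL j jc) (hηL : ∀ l, ηL l ∈ 𝓐.coinvariants)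
    {h : H} (h' : H) (x : (𝓗.lb.γ h).Rep) :
    ∑ i, hj.proj (hj.conv (x.fst i) h') * j (x.snd i) = hj.conv h h' := by
  obtain ⟨y⟩ := BalTensor.nonempty_rep (𝓗.rb.γ h)
  have := BalTensor₃.sum_eq_sum (𝓗.colinear_RL h x y)
    (((LinearMap.mul k A).compl₁₂ (hj.conv.flip h') jc).compr₂ ((LinearMap.mul k A).compl₂ j))
    (fun r x y z => by simp [rmulBy, mul_assoc, hj.conv_mul_sR hηL, hj.inv_mul_tR])
    (fun l x y z => by simp [lmulBy, hj.inv_tL_mul, hj.map_sL, mul_assoc])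
    (α := fun i => hj.proj (hj.conv (x.fst i) h') * j (x.snd i))
    (β := fun i => hj.conv (y.fst i * 𝓗.rb.s (𝓗.rb.π (y.snd i))) h')
    (fun i r => by
      rw [hj.proj_rep ⟨r.n, _, _, hj.ρR_conv hηL (x.fst i) h' r⟩]
      simp [Finset.sum_mul])
    (fun i r => by
      simp [hj.conv_mul_sR hηL, ← hj.convInverse.left_inv _ r, Finset.mul_sum, mul_assoc])
  rw [this]
  simp only [← LinearMap.sum_apply, ← map_sum, 𝓗.rb.counit_right]

theorem sum_proj_map_mul_mul (hj : 𝓐.IsCleaving ηL j jc) {b : A} (hb : b ∈ 𝓐.coinvariants) {h : H}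
    (x : (𝓗.lb.γ h).Rep) : ∑ i, hj.proj (j (x.fst i) * b) * j (x.snd i) = j h * b :=
  hj.sum_proj_mul_of_eq_sum
    (𝓐.ρL_mul_coinvariant hb (j h) ⟨x.n, _, _, hj.colinear.map_ρL h x⟩)

theorem sum_proj_map_mul_map_mul (hj : 𝓐.IsCleaving ηL j jc) {h h' : H} (x : (𝓗.lb.γ h).Rep)
    (y : (𝓗.lb.γ h').Rep) :
    ∑ i, ∑ p, hj.proj (j (x.fst i) * j (y.fst p)) * j (x.snd i * y.snd p) = j h * j h' := by
  have e := 𝓐.ρL_mul (j h) (j h') ⟨x.n, _, _, hj.colinear.map_ρL h x⟩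
    ⟨y.n, _, _, hj.colinear.map_ρL h' y⟩
  rw [← Fintype.sum_prod_type'] at e
  rw [← hj.sum_proj_mul_of_eq_sum e, Fintype.sum_prod_type]

/-- Under $j$, left multiplication by $t_L(l)$ becomes the right $L$-action on $A$, which $E$ turns
into right multiplication by $\eta_L(l)$. -/
theorem proj_map_tL_mul (hj : 𝓐.IsCleaving ηL j jc) (l : L) (h : H) (a : A) :
    hj.proj (j (𝓗.lb.t (op l) * h) * a) = hj.proj (j h * a) * ηL l := by
  rw [← hj.proj_actL, 𝓐.actL_eq, hj.map_tL_mul, mul_assoc]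

theorem map_mul_tL_mul_map (hj : 𝓐.IsCleaving ηL j jc) (l : L) (h h' : H) :
    j (h * 𝓗.lb.t (op l)) * j h' = j h * j (𝓗.lb.t (op l) * h') := by
  rw [← 𝓗.sR_πR_tL, hj.map_mul_sR, hj.map_sR_mul, mul_assoc]

/-- Expanding `conv` and regrouping the coproducts of $h'$ exposes
$\sigma(h_{(1)},u_{(1)})\,j(h_{(2)}u_{(2)})=j(h)j(u)$ at $u=h'^{(1)}$; what remains is
$j(h)\,j(h'^{(1)})j^c(h'^{(2)})$. This is half of the invertibility of $\sigma$. -/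
theorem sum_proj_map_mul_map_mul_conv (hj : 𝓐.IsCleaving ηL j jc) {h h' : H} (x : (𝓗.lb.γ h).Rep)
    (y : (𝓗.lb.γ h').Rep) :
    ∑ i, ∑ p, hj.proj (j (x.fst i) * j (y.fst p)) * hj.conv (x.snd i) (y.snd p) =
      j h * ηL (𝓗.lb.π h') := by
  obtain ⟨z⟩ := BalTensor.nonempty_rep (𝓗.rb.γ h')
  let σ : H →ₗ[k] H →ₗ[k] A := ((LinearMap.mul k A).compl₁₂ j j).compr₂ hj.proj
  let g : H →ₗ[k] H →ₗ[k] H →ₗ[k] A :=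
    ∑ i, ((LinearMap.mul k A).compl₁₂ (σ (x.fst i)) (j ∘ₗ LinearMap.mulLeft k (x.snd i))).compr₂
      ((LinearMap.mul k A).compl₂ jc)
  have hg : ∀ u v w, g u v w = (∑ i, hj.proj (j (x.fst i) * j u) * j (x.snd i * v)) * jc w :=
    fun u v w => by simp [g, σ, Finset.sum_mul]
  have := BalTensor₃.sum_eq_sum (𝓗.colinear_LR h' z y) g
    (fun l u v w => by
      -- Balancedness over $L$ is the Takeuchi condition for $\gamma_L(h)$.
      have := BalTensor.sum_congr_of_balanced
        ((LinearMap.mul k A).compl₁₂ (hj.proj ∘ₗ LinearMap.mulRight k (j u) ∘ₗ j)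
          (j ∘ₗ LinearMap.mulRight k v))
        (fun l x y => by simp [lmulBy, hj.proj_map_tL_mul, hj.map_sL, mul_assoc])
        (𝓗.lb.takeuchi l h x)
      simp only [LinearMap.compl₁₂_apply, LinearMap.comp_apply, LinearMap.mulRight_apply,
        LinearMap.mul_apply', hj.map_mul_tL_mul_map, mul_assoc] at this
      simp only [hg, lmulBy, LinearMap.mulLeft_apply, this])
    (fun r u v w => by
      simp [hg, rmulBy, ← mul_assoc, hj.map_mul_sR, hj.inv_mul_tR, ← Finset.sum_mul])
    (α := fun p => j h * (j (z.fst p) * jc (z.snd p)))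
    (β := fun p => ∑ i, hj.proj (j (x.fst i) * j (y.fst p)) * hj.conv (x.snd i) (y.snd p))
    (fun p r => by
      simp only [hg, ← Finset.sum_mul]
      rw [Finset.sum_comm, hj.sum_proj_map_mul_map_mul x r, mul_assoc])
    (fun p r => by
      simp only [hg, hj.conv_rep _ r, Finset.mul_sum, Finset.sum_mul, mul_assoc]
      exact Finset.sum_comm)
  rw [Finset.sum_comm, ← this, ← Finset.mul_sum, hj.convInverse.right_inv]

end IsCleaving

theorem IsCleft.coe_ι (hcleft : 𝓐.IsCleft ηL) (l : L) : (hcleft.ι l : A) = ηL l := rfl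

/-! ### The measuring, the cocycle and its inverse. -/

namespace IsCleaving

variable (hj : 𝓐.IsCleaving ηL j jc) (hcleft : 𝓐.IsCleft ηL)

/-- The map `IsCleaving.proj`, with values in the coinvariants. -/
def coinvProj : A →ₗ[k] 𝓐.coinvariants :=
  LinearMap.codRestrict (Subalgebra.toSubmodule 𝓐.coinvariants) hj.proj
    (hj.proj_mem hcleft.mem_coinvariants)

@[simp] theorem coe_coinvProj (a : A) : (hj.coinvProj hcleft a : A) = hj.proj a := rfl

theorem coinvProj_mul (b : 𝓐.coinvariants) (a : A) :
    hj.coinvProj hcleft (b * a) = b * hj.coinvProj hcleft a :=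
  Subtype.ext (hj.proj_coinvariant_mul b.2 a)

theorem coinvProj_actL (l : L) (a : A) :
    hj.coinvProj hcleft (𝓐.actL (op l) a) = hj.coinvProj hcleft a * hcleft.ι l :=
  Subtype.ext (hj.proj_actL l a)

theorem coinvProj_map (h : H) : hj.coinvProj hcleft (j h) = hcleft.ι (𝓗.lb.π h) :=
  Subtype.ext (hj.proj_map h)

/-- The map `(h, b) ↦ ∑ j(h⁽¹⁾) b jᶜ(h⁽²⁾)`. -/
def action : H →ₗ[k] 𝓐.coinvariants →ₗ[k] 𝓐.coinvariants :=
  ((LinearMap.mul k A).compl₁₂ j 𝓐.coinvariants.val.toLinearMap).compr₂ (hj.coinvProj hcleft)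

@[simp] theorem action_apply (h : H) (b : 𝓐.coinvariants) :
    hj.action hcleft h b = hj.coinvProj hcleft (j h * b) := rfl

theorem sum_coinvProj_map_mul_mul (b : 𝓐.coinvariants) {h : H} (x : (𝓗.lb.γ h).Rep) :
    ∑ i, (hj.coinvProj hcleft (j (x.fst i) * b) : A) * j (x.snd i) = j h * b :=
  hj.sum_proj_map_mul_mul b.2 x

theorem sum_coinvProj_map_mul_map_mul {h h' : H} (x : (𝓗.lb.γ h).Rep) (y : (𝓗.lb.γ h').Rep) :
    ∑ i, ∑ p, (hj.coinvProj hcleft (j (x.fst i) * j (y.fst p)) : A) * j (x.snd i * y.snd p) =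
      j h * j h' :=
  hj.sum_proj_map_mul_map_mul x y

/-- The measuring `h · b = ∑ j(h⁽¹⁾) b jᶜ(h⁽²⁾)`. -/
def measuring : Measuring 𝓗.lb hcleft.ι where
  act := hj.action hcleft
  act_one h := by simp [coinvProj_map]
  act_t l h b := Subtype.ext (hj.proj_map_tL_mul l h b)
  act_s l h b := by
    rw [action_apply, action_apply, ← coinvProj_mul, hj.map_sL, mul_assoc, IsCleft.coe_ι]
  -- The factor $E(j(h_{(1)})b)$ moves inside the other $E$, where reconstruction leaves
  -- $E(j(h)bb')$.
  act_mul h b b' x := by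
    simp only [action_apply, ← coinvProj_mul, ← map_sum]
    simp only [← mul_assoc, ← Finset.sum_mul, hj.sum_coinvProj_map_mul_mul hcleft,
      MulMemClass.coe_mul]

theorem measuring_act (h : H) (b : 𝓐.coinvariants) :
    (hj.measuring hcleft).act h b = hj.coinvProj hcleft (j h * b) := rfl

/-- The cocycle `σ(h, h') = ∑ j(h⁽¹⁾) j(h'⁽¹⁾) jᶜ(h⁽²⁾ h'⁽²⁾)`. -/
def cocycle (h1 : j 1 = 1) : TwoCocycle (hj.measuring hcleft) where
  σ := ((LinearMap.mul k A).compl₁₂ j j).compr₂ (hj.coinvProj hcleft)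
  balanced h l h' := by simp [hj.map_mul_tL_mul_map]
  map_s l h h' := by simp [hj.map_sL, mul_assoc, ← coinvProj_mul, IsCleft.coe_ι]
  map_t l h h' := Subtype.ext (hj.proj_map_tL_mul l h (j h'))
  -- Both sides are $E(j(h)\,\eta_L(l)\,j(h'))$.
  act_ι h l h' x := by
    simp only [measuring_act, LinearMap.compr₂_apply, LinearMap.compl₁₂_apply,
      LinearMap.mul_apply', ← coinvProj_mul, ← map_sum]
    have e := hj.sum_coinvProj_map_mul_mul hcleft (hcleft.ι l) x
    simp only [← mul_assoc, ← Finset.sum_mul, hj.map_sL, e]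
    rw [IsCleft.coe_ι, mul_assoc]
  one_left h := by simp [h1, coinvProj_map]
  one_right h := by simp [h1, coinvProj_map]
  cocycle h h' h'' x y z := by
    simp only [measuring_act, LinearMap.compr₂_apply, LinearMap.compl₁₂_apply,
      LinearMap.mul_apply', ← coinvProj_mul, ← map_sum]
    congr 1
    -- The common value inside $E$. One side uses reconstruction for $j(h')j(h'')$ and then for
    -- $j(h)$ times a coinvariant; the other uses it for $j(h)j(h')$ only.
    trans j h * (j h' * j h'')
    · rw [← hj.sum_coinvProj_map_mul_map_mul hcleft y z, Finset.sum_comm, Finset.mul_sum]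
      refine Finset.sum_congr rfl fun p _ => ?_
      rw [Finset.sum_comm, Finset.mul_sum]
      refine Finset.sum_congr rfl fun q _ => ?_
      simp only [← mul_assoc, ← Finset.sum_mul, hj.sum_coinvProj_map_mul_mul hcleft]
    · simp only [← mul_assoc, ← Finset.sum_mul, hj.sum_coinvProj_map_mul_map_mul hcleft]

theorem cocycle_σ (h1 : j 1 = 1) (h h' : H) :
    (hj.cocycle hcleft h1).σ h h' = hj.coinvProj hcleft (j h * j h') := rfl

theorem coinvProj_one (h1 : j 1 = 1) : hj.coinvProj hcleft 1 = 1 := by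
  rw [← h1, coinvProj_map, 𝓗.lb.π_one, map_one]

theorem isTwistedModule_cocycle (h1 : j 1 = 1) : (hj.cocycle hcleft h1).IsTwistedModule where
  one_act b := by
    rw [measuring_act, h1, one_mul, ← mul_one (b : A), coinvProj_mul, hj.coinvProj_one hcleft h1,
      mul_one]
  twisted h h' b x y := by
    simp only [measuring_act, cocycle_σ, ← coinvProj_mul, ← map_sum]
    congr 1
    trans j h * (j h' * b)
    · rw [← hj.sum_coinvProj_map_mul_mul hcleft b y, Finset.sum_comm, Finset.mul_sum]
      refine Finset.sum_congr rfl fun p _ => ?_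
      simp only [← mul_assoc, ← Finset.sum_mul, hj.sum_coinvProj_map_mul_mul hcleft]
    · simp only [← mul_assoc, ← Finset.sum_mul, hj.sum_coinvProj_map_mul_map_mul hcleft]

/-- By `ρR_conv`, the inverse chosen is
$\tau(h,h')=j(h^{(1)}h'^{(1)})\,j^c(h'^{(2)})\,j^c(h^{(2)})$. -/
theorem isInvertible_cocycle (h1 : j 1 = 1) : (hj.cocycle hcleft h1).IsInvertible := by
  have e : ∀ {h : H} (h' : H) (x : (𝓗.lb.γ h).Rep),
      ∑ i, (hj.coinvProj hcleft (hj.conv (x.fst i) h') : A) * j (x.snd i) = hj.conv h h' :=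
    fun h' x => hj.sum_proj_conv_mul hcleft.mem_coinvariants h' x
  refine ⟨hj.conv.compr₂ (hj.coinvProj hcleft), ?_, ?_, ?_, ?_, ?_, ?_⟩
  · intro h l h'
    simp [hj.conv_mul_sL]
  · intro l h h'
    simp [hj.conv_sL_mul, ← coinvProj_mul, IsCleft.coe_ι]
  · intro l h h'
    simp [hj.conv_tL_mul, coinvProj_actL]
  · intro h l h' x
    simp only [measuring_act, LinearMap.compr₂_apply, ← coinvProj_mul, ← map_sum]
    simp only [← mul_assoc, ← Finset.sum_mul, e, hj.conv_right_tL_mul, IsCleft.coe_ι]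
  · intro h h' x y
    simp only [measuring_act, cocycle_σ, LinearMap.compr₂_apply, ← coinvProj_mul, ← map_sum]
    simp only [coe_coinvProj, hj.sum_proj_map_mul_map_mul_conv x y, OneMemClass.coe_one, mul_one,
      hj.proj_map]
  · intro h h' x y
    simp only [measuring_act, cocycle_σ, LinearMap.compr₂_apply, ← coinvProj_mul, ← map_sum,
      OneMemClass.coe_one, mul_one]
    rw [Finset.sum_comm]
    simp only [← mul_assoc, ← Finset.sum_mul, e, hj.sum_conv_mul]

/-! ### The isomorphism with the crossed product. -/

/-- The map `b ⊗_L h ↦ b j(h)`. -/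
def ofCrossed : CrossedCarrier 𝓗.lb hcleft.ι →ₗ[k] A :=
  BalTensor.lift ((LinearMap.mul k A).compl₁₂ 𝓐.coinvariants.val.toLinearMap j)
    (fun l b h => by simp [rmulBy, lmulBy, hj.map_sL, mul_assoc, IsCleft.coe_ι])

@[simp] theorem ofCrossed_tmul (b : 𝓐.coinvariants) (h : H) :
    hj.ofCrossed hcleft (BalTensor.tmul b h) = b * j h := by
  simp [ofCrossed]

theorem ofCrossed_rep {z : CrossedCarrier 𝓗.lb hcleft.ι} (x : z.Rep) :
    hj.ofCrossed hcleft z = ∑ i, (x.fst i : A) * j (x.snd i) := by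
  rw [x.map_eq (hj.ofCrossed hcleft)]
  simp

theorem tmul_coinvProj_actL (l : L) (a : A) (h : H) :
    (BalTensor.mk (rmulBy k fun l => hcleft.ι l) (lmulBy k fun l => 𝓗.lb.s l) ∘ₗ
      hj.coinvProj hcleft) (𝓐.actL (op l) a) h =
    (BalTensor.mk (rmulBy k fun l => hcleft.ι l) (lmulBy k fun l => 𝓗.lb.s l) ∘ₗ
      hj.coinvProj hcleft) a (lmulBy k (fun l => 𝓗.lb.s l) l h) := by
  simp [BalTensor.mk_apply, coinvProj_actL, lmulBy, CrossedCarrier.tmul_ι]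

/-- The map `a ⊗_L h ↦ E(a) ⊗_L h`, for the projection `E` of `A` onto the coinvariants. -/
def toCrossedAux : BalTensor (fun l => 𝓐.actL (op l)) (lmulBy k fun l => 𝓗.lb.s l) →ₗ[k]
    CrossedCarrier 𝓗.lb hcleft.ι :=
  BalTensor.lift (BalTensor.mk (rmulBy k fun l => hcleft.ι l) (lmulBy k fun l => 𝓗.lb.s l) ∘ₗ
      hj.coinvProj hcleft) (hj.tmul_coinvProj_actL hcleft)

/-- The map `a ↦ ∑ E(a₍₀₎) ⊗_L a₍₁₎`, for the projection `E` of `A` onto the coinvariants. -/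
def toCrossed : A →ₗ[k] CrossedCarrier 𝓗.lb hcleft.ι := hj.toCrossedAux hcleft ∘ₗ 𝓐.ρL

theorem toCrossed_rep {a : A} (x : (𝓐.ρL a).Rep) :
    hj.toCrossed hcleft a = ∑ i, BalTensor.tmul (hj.coinvProj hcleft (x.fst i)) (x.snd i) :=
  BalTensor.lift_rep _ (hj.tmul_coinvProj_actL hcleft) x

/-- The isomorphism `A ≃ B ⊗_L H`. -/
def crossedEquiv : A ≃ₗ[k] CrossedCarrier 𝓗.lb hcleft.ι :=
  LinearEquiv.ofLinearMap (hj.toCrossed hcleft) (hj.ofCrossed hcleft)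
    -- Here $E(b\,j(h_{(1)}))\otimes h_{(2)}=b\,\eta_L(\pi_L(h_{(1)}))\otimes h_{(2)}=b\otimes h$,
    -- by the left counit.
    (BalTensor.hom_ext fun b h => by
      obtain ⟨x⟩ := BalTensor.nonempty_rep (𝓗.lb.γ h)
      have e := 𝓐.ρL_coinvariant_mul b.2 (j h) ⟨x.n, _, _, hj.colinear.map_ρL h x⟩
      simp only [LinearMap.comp_apply, ofCrossed_tmul, LinearMap.id_apply]
      rw [hj.toCrossed_rep hcleft ⟨x.n, _, _, e⟩]
      simp only [coinvProj_mul, coinvProj_map, CrossedCarrier.tmul_ι]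
      rw [← BalTensor.tmul_sum, 𝓗.lb.counit_left])
    (LinearMap.ext fun a => by
      obtain ⟨x⟩ := BalTensor.nonempty_rep (𝓐.ρL a)
      simp [hj.toCrossed_rep hcleft x, hj.sum_proj_mul])

theorem crossedEquiv_symm_apply (z : CrossedCarrier 𝓗.lb hcleft.ι) :
    (hj.crossedEquiv hcleft).symm z = hj.ofCrossed hcleft z := rfl

theorem crossedEquiv_coinvariant_mul_map (b : 𝓐.coinvariants) (h : H) :
    hj.crossedEquiv hcleft (b * j h) = BalTensor.tmul b h := by
  rw [← hj.ofCrossed_tmul hcleft]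
  exact (hj.crossedEquiv hcleft).apply_symm_apply _

theorem eq_sum_of_rep {a : A} (x : (hj.crossedEquiv hcleft a).Rep) :
    a = ∑ i, (x.fst i : A) * j (x.snd i) := by
  rw [← hj.ofCrossed_rep hcleft x]
  exact ((hj.crossedEquiv hcleft).symm_apply_apply a).symm

/-- The image $b\,(h_{(1)}\cdot b')\,\sigma(h_{(2)},h'_{(1)})\,j(h_{(3)}h'_{(2)})$ collapses from
the right: the last two factors give $j(h_{(2)})j(h')$, and then $(h_{(1)}\cdot b')\,j(h_{(2)})$
gives $j(h)b'$. -/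
theorem ofCrossed_mul (h1 : j 1 = 1) (z z' : CrossedCarrier 𝓗.lb hcleft.ι) :
    hj.ofCrossed hcleft ((hj.cocycle hcleft h1).mul z z') =
      hj.ofCrossed hcleft z * hj.ofCrossed hcleft z' := by
  induction z using BalTensor.induction_on with
  | zero => simp
  | add z w hz hw => simp only [map_add, LinearMap.add_apply, hz, hw, add_mul]
  | tmul b h =>
    induction z' using BalTensor.induction_on with
    | zero => simp
    | add z w hz hw => simp only [map_add, hz, hw, mul_add]
    | tmul b' h' =>
      obtain ⟨x⟩ := BalTensor.nonempty_rep (𝓗.lb.γ h)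
      obtain ⟨y⟩ := BalTensor.nonempty_rep (𝓗.lb.γ h')
      rw [TwoCocycle.mul_tmul_tmul _ b h b' h' x
        (fun i => (BalTensor.nonempty_rep (𝓗.lb.γ (x.snd i))).some) y]
      simp only [map_sum, ofCrossed_tmul, MulMemClass.coe_mul, cocycle_σ, measuring_act, mul_assoc,
        ← Finset.mul_sum, hj.sum_coinvProj_map_mul_map_mul hcleft]
      simp only [← mul_assoc, ← Finset.sum_mul]
      simp only [mul_assoc (b : A), hj.sum_coinvProj_map_mul_mul hcleft]

theorem isAlgebra_cocycle (h1 : j 1 = 1) : (hj.cocycle hcleft h1).IsAlgebra := by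
  have inj : Function.Injective (hj.ofCrossed hcleft) := (hj.crossedEquiv hcleft).symm.injective
  refine ⟨fun x y z => inj ?_, fun x => inj ?_, fun x => inj ?_⟩ <;>
    simp [ofCrossed_mul, mul_assoc, h1]

theorem crossedEquiv_actR (r : R) (a : A) (x : (hj.crossedEquiv hcleft a).Rep) :
    hj.crossedEquiv hcleft (𝓐.actR (op r) a) =
      ∑ i, BalTensor.tmul (x.fst i) (x.snd i * 𝓗.rb.s r) := by
  -- Only the argument of the equivalence is rewritten, since the type of `x` also mentions `a`.
  nth_rewrite 1 [hj.eq_sum_of_rep hcleft x]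
  simp [𝓐.actR_eq, Finset.sum_mul, mul_assoc, ← hj.map_mul_sR, crossedEquiv_coinvariant_mul_map]

theorem crossedEquiv_actL (l : L) (a : A) (x : (hj.crossedEquiv hcleft a).Rep) :
    hj.crossedEquiv hcleft (𝓐.actL (op l) a) =
      ∑ i, BalTensor.tmul (x.fst i) (𝓗.lb.t (op l) * x.snd i) := by
  nth_rewrite 1 [hj.eq_sum_of_rep hcleft x]
  simp [𝓐.actL_eq, Finset.mul_sum, ← mul_assoc, 𝓐.ηR_mul_coinvariant _ (x.fst _).2]
  simp [mul_assoc, ← hj.map_tL_mul, crossedEquiv_coinvariant_mul_map]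

end IsCleaving
end HopfAlgebroid.ComoduleAlgebra

/-! ### Compatibility of the isomorphism with the coactions. -/

theorem BalTensor₃.left_balanced {k : Type u₁} [CommRing k] {P : Type u₂} {Q : Type u₃}
    {M : Type u₄} [AddCommGroup M] [Module k M] {N : Type u₅} [AddCommGroup N] [Module k N]
    {T : Type u₆} [AddCommGroup T] [Module k T]
    {a : P → Module.End k M} {b : P → Module.End k N}
    {c : Q → Module.End k N} {d : Q → Module.End k T} (q : Q) (m : M) (n : N) (t : T) :
    (BalTensor₃.left (BalTensor.tmul m (c q n)) t : BalTensor₃ a b c d) =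
      BalTensor₃.left (BalTensor.tmul m n) (d q t) := by
  rw [left_tmul, left_tmul, ← right_tmul, ← right_tmul, BalTensor.tmul_balanced]

namespace HopfAlgebroid.ComoduleAlgebra

variable {k : Type u₁} {L : Type u₂} {R : Type u₃} {H : Type u₄} [CommRing k]
  [Ring L] [Algebra k L] [Ring R] [Algebra k R] [Ring H] [Algebra k H]
  {𝓗 : HopfAlgebroid k L R H} {A : Type u₅} [Ring A] [Algebra k A]
  {𝓐 : 𝓗.ComoduleAlgebra A} {ηL : L →ₐ[k] A} {j jc : H →ₗ[k] A}

namespace IsCleaving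

variable (hj : 𝓐.IsCleaving ηL j jc) (hcleft : 𝓐.IsCleft ηL)

/-- The left-hand side depends only on $\varrho_R(a)$, by balancedness. It can therefore be computed
after writing $a$ as a sum of terms $b\,j(h)$, where $\varrho_R(b\,j(h))=b\,j(h^{(1)})\otimes
h^{(2)}$. -/
theorem crossedEquiv_ρR (a : A) (x : (𝓐.ρR a).Rep) (y : (hj.crossedEquiv hcleft a).Rep) :
    (∑ i, BalTensor₃.left (hj.crossedEquiv hcleft (x.fst i)) (x.snd i) :
      BalTensor₃ (rmulBy k fun l => hcleft.ι l) (lmulBy k fun l => 𝓗.lb.s l)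
        (rmulBy k fun r => 𝓗.rb.s r) (rmulBy k fun r => 𝓗.rb.t (op r))) =
    ∑ i, BalTensor₃.right (y.fst i) (𝓗.rb.γ (y.snd i)) := by
  have bal : ∀ r a h, (BalTensor₃.left (hj.crossedEquiv hcleft (𝓐.actR (op r) a)) h :
      BalTensor₃ (rmulBy k fun l => hcleft.ι l) (lmulBy k fun l => 𝓗.lb.s l)
        (rmulBy k fun r => 𝓗.rb.s r) (rmulBy k fun r => 𝓗.rb.t (op r))) =
      BalTensor₃.left (hj.crossedEquiv hcleft a) (h * 𝓗.rb.t (op r)) := by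
    intro r a h
    obtain ⟨z⟩ := BalTensor.nonempty_rep (hj.crossedEquiv hcleft a)
    rw [hj.crossedEquiv_actR hcleft r a z, z.map_eq BalTensor₃.left, map_sum,
      LinearMap.sum_apply, LinearMap.sum_apply]
    exact Finset.sum_congr rfl fun i _ =>
      BalTensor₃.left_balanced (c := rmulBy k fun r => 𝓗.rb.s r) r (z.fst i) (z.snd i) h
  have e := BalTensor.lift_rep
    (BalTensor₃.left ∘ₗ (hj.crossedEquiv hcleft).toLinearMap) bal x
  refine e.symm.trans ?_
  nth_rewrite 1 [hj.eq_sum_of_rep hcleft y]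
  rw [map_sum, map_sum]
  refine Finset.sum_congr rfl fun i _ => ?_
  obtain ⟨z⟩ := BalTensor.nonempty_rep (𝓗.rb.γ (y.snd i))
  have e' := 𝓐.ρR_coinvariant_mul (y.fst i).2 (j (y.snd i))
    ⟨z.n, _, _, hj.colinear.map_ρR _ z⟩
  refine (BalTensor.lift_rep _ _ ⟨z.n, _, _, e'⟩).trans ?_
  rw [z.map_eq (BalTensor₃.right (y.fst i))]
  simp [crossedEquiv_coinvariant_mul_map]

theorem crossedEquiv_ρL (a : A) (x : (𝓐.ρL a).Rep) (y : (hj.crossedEquiv hcleft a).Rep) :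
    (∑ i, BalTensor₃.left (hj.crossedEquiv hcleft (x.fst i)) (x.snd i) :
      BalTensor₃ (rmulBy k fun l => hcleft.ι l) (lmulBy k fun l => 𝓗.lb.s l)
        (lmulBy k fun l => 𝓗.lb.t (op l)) (lmulBy k fun l => 𝓗.lb.s l)) =
    ∑ i, BalTensor₃.right (y.fst i) (𝓗.lb.γ (y.snd i)) := by
  have bal : ∀ l a h, (BalTensor₃.left (hj.crossedEquiv hcleft (𝓐.actL (op l) a)) h :
      BalTensor₃ (rmulBy k fun l => hcleft.ι l) (lmulBy k fun l => 𝓗.lb.s l)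
        (lmulBy k fun l => 𝓗.lb.t (op l)) (lmulBy k fun l => 𝓗.lb.s l)) =
      BalTensor₃.left (hj.crossedEquiv hcleft a) (𝓗.lb.s l * h) := by
    intro l a h
    obtain ⟨z⟩ := BalTensor.nonempty_rep (hj.crossedEquiv hcleft a)
    rw [hj.crossedEquiv_actL hcleft l a z, z.map_eq BalTensor₃.left, map_sum,
      LinearMap.sum_apply, LinearMap.sum_apply]
    exact Finset.sum_congr rfl fun i _ =>
      BalTensor₃.left_balanced (c := lmulBy k fun l => 𝓗.lb.t (op l)) l (z.fst i) (z.snd i) h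
  have e := BalTensor.lift_rep
    (BalTensor₃.left ∘ₗ (hj.crossedEquiv hcleft).toLinearMap) bal x
  refine e.symm.trans ?_
  nth_rewrite 1 [hj.eq_sum_of_rep hcleft y]
  rw [map_sum, map_sum]
  refine Finset.sum_congr rfl fun i _ => ?_
  obtain ⟨z⟩ := BalTensor.nonempty_rep (𝓗.lb.γ (y.snd i))
  have e' := 𝓐.ρL_coinvariant_mul (y.fst i).2 (j (y.snd i))
    ⟨z.n, _, _, hj.colinear.map_ρL _ z⟩
  refine (BalTensor.lift_rep _ _ ⟨z.n, _, _, e'⟩).trans ?_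
  rw [z.map_eq (BalTensor₃.right (y.fst i))]
  simp [crossedEquiv_coinvariant_mul_map]

theorem isCrossedIso_crossedEquiv (h1 : j 1 = 1) :
    𝓐.IsCrossedIso (hj.cocycle hcleft h1) (hj.crossedEquiv hcleft) where
  map_one := by
    simpa [h1] using hj.crossedEquiv_coinvariant_mul_map hcleft 1 1
  map_mul a a' := by
    apply (hj.crossedEquiv hcleft).symm.injective
    simp only [LinearEquiv.symm_apply_apply]
    simp only [crossedEquiv_symm_apply, ofCrossed_mul]
    simp only [← crossedEquiv_symm_apply, LinearEquiv.symm_apply_apply]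
  map_smulB b a := by
    obtain ⟨x⟩ := BalTensor.nonempty_rep (hj.crossedEquiv hcleft a)
    rw [x.map_eq (CrossedCarrier.smulB b)]
    nth_rewrite 1 [hj.eq_sum_of_rep hcleft x]
    simp only [Finset.mul_sum, map_sum, ← mul_assoc, ← MulMemClass.coe_mul,
      crossedEquiv_coinvariant_mul_map, CrossedCarrier.smulB_tmul]
  map_actR := hj.crossedEquiv_actR hcleft
  map_actL := hj.crossedEquiv_actL hcleft
  map_ρR := hj.crossedEquiv_ρR hcleft
  map_ρL := hj.crossedEquiv_ρL hcleft

/-! ### Normalising a cleaving map by the unit $j(1)$ of $B$. -/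

theorem map_one_mem (hj : 𝓐.IsCleaving ηL j jc) : j 1 ∈ 𝓐.coinvariants := by
  simpa [mem_coinvariants] using hj.colinear.map_ρR 1 (BalTensor.Rep.single 𝓗.rb.γ_one)

theorem inv_one_mem (hj : 𝓐.IsCleaving ηL j jc) (hηL : ∀ l, ηL l ∈ 𝓐.coinvariants) :
    jc 1 ∈ 𝓐.coinvariants := by
  rw [← hj.proj_one]
  exact hj.proj_mem hηL 1

theorem map_one_mul_inv_one (hj : 𝓐.IsCleaving ηL j jc) : j 1 * jc 1 = 1 := by
  simpa [𝓗.lb.π_one] using hj.convInverse.right_inv 1 (BalTensor.Rep.single 𝓗.rb.γ_one)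

theorem inv_one_mul_map_one (hj : 𝓐.IsCleaving ηL j jc) : jc 1 * j 1 = 1 := by
  simpa [𝓗.rb.π_one] using hj.convInverse.left_inv 1 (BalTensor.Rep.single 𝓗.lb.γ_one)

/-- The normalisation `h ↦ j(h) jᶜ(1)` of a cleaving map `j`. -/
theorem normalise (hj : 𝓐.IsCleaving ηL j jc) (hηL : ∀ l, ηL l ∈ 𝓐.coinvariants) :
    𝓐.IsCleaving ηL (LinearMap.mulRight k (jc 1) ∘ₗ j) (LinearMap.mulLeft k (j 1) ∘ₗ jc) where
  map_sL l h := by simp [hj.map_sL, mul_assoc]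
  colinear :=
    { map_actR := fun h r => by
        simp [hj.map_mul_sR, 𝓐.actR_eq, mul_assoc,
          𝓐.ηR_mul_coinvariant r (hj.inv_one_mem hηL)]
      map_actL := fun h l => by simp [hj.map_tL_mul, 𝓐.actL_eq, mul_assoc]
      map_ρR := fun h x =>
        𝓐.ρR_mul_coinvariant (hj.inv_one_mem hηL) _ ⟨x.n, _, _, hj.colinear.map_ρR h x⟩
      map_ρL := fun h x =>
        𝓐.ρL_mul_coinvariant (hj.inv_one_mem hηL) _ ⟨x.n, _, _, hj.colinear.map_ρL h x⟩ }
  convInverse :=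
    { map_t := fun l r h => by
        simp [hj.convInverse.map_t, ← mul_assoc, 𝓐.ηR_mul_coinvariant r hj.map_one_mem]
      right_inv := fun h x => by
        rw [← hj.convInverse.right_inv h x]
        refine Finset.sum_congr rfl fun i _ => ?_
        simp only [LinearMap.comp_apply, LinearMap.mulRight_apply, LinearMap.mulLeft_apply]
        rw [mul_assoc, ← mul_assoc (jc 1), hj.inv_one_mul_map_one, one_mul]
      left_inv := fun h x => by
        -- Conjugation by $j(1)$ fixes the image of $\eta_R$, since coinvariants commute with it.
        have := congrArg (fun a => j 1 * a * jc 1) (hj.convInverse.left_inv h x)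
        simp only [← 𝓐.ηR_mul_coinvariant _ hj.map_one_mem] at this
        rw [mul_assoc (𝓐.ηR _), hj.map_one_mul_inv_one, mul_one] at this
        simpa [Finset.mul_sum, Finset.sum_mul, mul_assoc] using this }

end IsCleaving
end HopfAlgebroid.ComoduleAlgebra

theorem mainTheorem2 {k : Type u₁} {L : Type u₂} {R : Type u₃} {H : Type u₄} {A : Type u₅}
    [CommRing k] [Ring L] [Algebra k L] [Ring R] [Algebra k R] [Ring H] [Algebra k H]
    [Ring A] [Algebra k A]
    (𝓗 : HopfAlgebroid k L R H) (𝓐 : 𝓗.ComoduleAlgebra A) (ηL : L →ₐ[k] A)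
    (hcleft : 𝓐.IsCleft ηL) :
    (∃ j jc : H →ₗ[k] A, 𝓐.IsCleaving ηL j jc ∧ j 1 = 1 ∧ jc 1 = 1) ∧
    ∀ j jc : H →ₗ[k] A, 𝓐.IsCleaving ηL j jc → j 1 = 1 → jc 1 = 1 →
      ∃ (μ : Measuring 𝓗.lb hcleft.ι) (c : TwoCocycle μ),
        (∀ h (b : 𝓐.coinvariants) (x : (𝓗.rb.γ h).Rep),
          (μ.act h b : A) = ∑ i, j (x.fst i) * b * jc (x.snd i)) ∧
        (∀ h h' (x : (𝓗.rb.γ h).Rep) (y : (𝓗.rb.γ h').Rep),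
          (c.σ h h' : A) =
            ∑ i, ∑ p, j (x.fst i) * j (y.fst p) * jc (x.snd i * y.snd p)) ∧
        c.IsTwistedModule ∧ c.IsInvertible ∧ c.IsAlgebra ∧
        ∃ φ : A ≃ₗ[k] CrossedCarrier 𝓗.lb hcleft.ι, 𝓐.IsCrossedIso c φ := by
  refine ⟨?_, fun j jc hj h1 _ => ⟨hj.measuring hcleft, hj.cocycle hcleft h1, fun h b x => ?_,
    fun h h' x y => ?_, hj.isTwistedModule_cocycle hcleft h1, hj.isInvertible_cocycle hcleft h1,
    hj.isAlgebra_cocycle hcleft h1, hj.crossedEquiv hcleft,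
    hj.isCrossedIso_crossedEquiv hcleft h1⟩⟩
  · obtain ⟨j, jc, hj⟩ := hcleft.exists_cleaving
    exact ⟨_, _, hj.normalise hcleft.mem_coinvariants, by simp [hj.map_one_mul_inv_one],
      by simp [hj.map_one_mul_inv_one]⟩
  -- The stated formulas for $h\cdot b$ and $\sigma$ are $E(j(h)b)$ and $E(j(h)j(h'))$ expanded
  -- along $\varrho_R$.
  · exact hj.proj_rep ⟨x.n, _, _,
      𝓐.ρR_mul_coinvariant b.2 (j h) ⟨x.n, _, _, hj.colinear.map_ρR h x⟩⟩
  · have e := 𝓐.ρR_mul (j h) (j h') ⟨x.n, _, _, hj.colinear.map_ρR h x⟩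
      ⟨y.n, _, _, hj.colinear.map_ρR h' y⟩
    rw [← Fintype.sum_prod_type'] at e
    rw [← Fintype.sum_prod_type']
    exact hj.proj_of_eq_sum e
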